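/- Let $d\ge 0$ be an integer and $\sigma_{\min},\sigma_{\max}>0$. Then there are constants $C>0$ and $N_0\ge 1$, depending only on $(\sigma_{\max},\sigma_{\min},d)$, such that the following holds for every $\gamma\in(\tfrac34,1)$ and every integer $N\ge N_0$. Let $M=N^{\gamma}$ and $K=N^{(1-\gamma)/2}$, each rounded up or down to an integer. Let $\Sigma\in\mathbb R^{p\times p}$ be positive definite, let $G$ be a graph on $[p]=\{1,\dots,p\}$ with maximum degree at most $d$ such that $(\Sigma^{-1})_{ab}=0$ whenever $a\ne b$ and $(a,b)\notin G$ (that is, $\mathcal N(0,\Sigma)$ is an undirected graphical model with respect to $G$), and suppose that for every $S\subseteq[p]$ with $|S|\le d+4$ all eigenvalues of the principal submatrix $\Sigma_{S}$ lie in $[\sigma_{\min},\sigma_{\max}]$. For a symmetric matrix $A$, nodes $i\neq j$ and $S\subseteq[p]\setminus\{i,j\}$ put, with $Q=S\cup\{i,j\}$, $$\rho_{ij\mid S}(A)=-\frac{((A_{Q,Q})^{-1})_{ij}}{\sqrt{((A_{Q,Q})^{-1})_{ii}\,((A_{Q,Q})^{-1})_{jj}}}$$ (with value $0$ if $A_{Q,Q}$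 is singular), and write $\rho_{ij\mid S}=\rho_{ij\mid S}(\Sigma)$. Let $x^{(1)},\dots,x^{(N)}$ be i.i.d. $\mathcal N(0,\Sigma)$, and let $B_1,\dots,B_K$ be independent, uniformly random subsets of $\{1,\dots,N\}$ of size $M$, independent of the data. Let $i\ne j$ with $(i,j)\notin G$, and let $S_1,\dots,S_K\subseteq[p]\setminus\{i,j\}$ satisfy $|S_k|\le d+2$ and $\rho_{ij\mid S_k}=0$ for all $k$. Let $\hat\rho_{ij\mid S_k}=\rho_{ij\mid S_k}(\hat\Sigma_k)$, where $\hat\Sigma_k=\frac1M\sum_{n\in B_k}x^{(n)}(x^{(n)})^{T}$. Then $$\Pr\bigl(\hat\rho_{ij\mid S_k}>0\ \ \forall k\in[K]\bigr)\le\exp\Bigl(-C\,N^{\min\{(1-\gamma)/2,\;4\gamma-3\}}\Bigr).$$ -/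

import Mathlib

open MeasureTheory ProbabilityTheory

noncomputable section

/-- The principal submatrix of `A` with rows and columns in `S`. -/
def principalSubmatrix {p : ℕ} (A : Matrix (Fin p) (Fin p) ℝ) (S : Finset (Fin p)) :
    Matrix S S ℝ :=
  A.submatrix (fun a => (a : Fin p)) (fun a => (a : Fin p))

/-- The partial correlation coefficient of `i` and `j` given `S` computed from the covariance
matrix `A`: with `Q` the inverse of the principal submatrix of `A` on `S ∪ {i, j}`, it is
`- Q i j / √(Q i i * Q j j)`. (If that submatrix is singular, the value is `0`.) -/
def partialCorr {p : ℕ} (A : Matrix (Fin p) (Fin p) ℝ) (i j : Fin p) (S : Finset (Fin p)) : ℝ :=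
  let Q := (principalSubmatrix A (insert i (insert j S)))⁻¹
  let i' : (insert i (insert j S) : Finset (Fin p)) := ⟨i, by simp⟩
  let j' : (insert i (insert j S) : Finset (Fin p)) := ⟨j, by simp⟩;
  -(Q i' j') / √(Q i' i' * Q j' j')

/-- The (mean zero) sample covariance matrix of those observations `x n` whose index `n` lies in
the batch `b`: `(1 / |b|) ∑_{n ∈ b} x n (x n)ᵀ`. -/
def sampleCov {p N : ℕ} (x : Fin N → EuclideanSpace ℝ (Fin p)) (b : Finset (Fin N)) :
    Matrix (Fin p) (Fin p) ℝ :=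
  Matrix.of fun a c => (b.card : ℝ)⁻¹ * ∑ n ∈ b, x n a * x n c

/-- The centred Gaussian distribution with nonsingular covariance matrix `A` is an undirected
graphical model for `G`: the precision matrix `A⁻¹` vanishes off the edges of `G`. -/
def IsGaussianGraphicalModel {p : ℕ} (A : Matrix (Fin p) (Fin p) ℝ)
    (G : SimpleGraph (Fin p)) : Prop :=
  A.PosDef ∧ ∀ a c, a ≠ c → ¬ G.Adj a c → A⁻¹ a c = 0

/-- All eigenvalues of the principal submatrices of `A` of size at most `m` lie in `[lo, hi]`. -/
def BoundedPrincipalEigenvalues {p : ℕ} (A : Matrix (Fin p) (Fin p) ℝ) (m : ℕ) (lo hi : ℝ) :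
    Prop :=
  ∀ S : Finset (Fin p), S.card ≤ m → ∀ μ : ℝ,
    Module.End.HasEigenvalue (Matrix.toLin' (principalSubmatrix A S)) μ → lo ≤ μ ∧ μ ≤ hi

/-- `X 0, …, X (N-1)` are i.i.d. centred Gaussian vectors with covariance matrix `A`, and
`B 0, …, B (K-1)` are independent, uniformly distributed subsets of size `M` of the set of sample
indices, independent of the observations. -/
structure IsBatchedGaussianSample {Ω : Type*} [MeasurableSpace Ω] (P : Measure Ω) {p N K : ℕ}
    (A : Matrix (Fin p) (Fin p) ℝ) (M : ℕ) (X : Fin N → Ω → EuclideanSpace ℝ (Fin p))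
    (B : Fin K → Ω → Finset (Fin N)) : Prop where
  law_obs : ∀ n, HasLaw (X n) (multivariateGaussian 0 A) P
  indep_obs : iIndepFun X P
  law_batch : ∀ k, HasLaw (B k) (uniformOn {b : Finset (Fin N) | b.card = M}) P
  indep_batch : iIndepFun B P
  indep_obs_batch : IndepFun (fun ω n => X n ω) (fun ω k => B k ω) P

end

/-!
The proof bounds the probability by `exp (-c K)` with `K ≈ N ^ ((1 - γ) / 2)`, which is stronger
than the claim.

*One batch.* Fix a batch `b` and a separating set `S`. Let `v n` be the residual of coordinate `j`
of sample `n` after regressing, within the batch, on the coordinates in `S`. If the sample partial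
correlation is positive, then `∑ n ∈ b, v n * (w ⬝ x n) > 0` (`sum_sampleResidual_mul_pos`), where
`w` is the normalized row `i` of the inverse covariance matrix of `S ∪ {i, j}`. As `ρ = 0`, `w ⬝
x` is a standard Gaussian independent of the coordinates `S ∪ {j}`, on which alone `v` depends. It
can therefore be replaced by a fresh Gaussian without changing the law of the data or the
residuals (`exists_resampling_direction`, `measurePreserving_resample_pi`).

*All batches.* Two batches share about `M² / N ≈ M / K²` samples, so all but a fraction of order
`1 / K` of each batch is private to it, except with exponentially small probability
(`IsBatchedGaussianSample.measureReal_le_card_inter_le`). Resampling the private parts only, the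
`K` statistics become conditionally independent Gaussians. Each is positive with probability at
most `P(Z > -1) < 1`, provided its mean, the contribution of the shared samples, is at most its
standard deviation (`measureReal_forall_stat_pos_le`).

*Shared samples.* Resampling now the shared part of one batch shows that its contribution is,
given the residuals, a centred Gaussian, whose variance is a fraction of order `1 / K` of the
private one (`measureReal_sqrt_lt_shared_le`). This ratio of residual sums of squares is
controlled by concentration of the Gram matrices of the at most `d + 3` coordinates `S ∪ {j}`
together with the eigenvalue bounds (`measureReal_sampleResidual_lt_le`). So the mean exceeds the
standard deviation with probability at most `exp (-c K)`, and a union bound over the batches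
finishes the argument for large `K`. For bounded `K` a single batch is enough, as `N ^ ((1 - γ) /
2) ≤ K + 1`.
-/

/-! ### Gaussian resampling -/

theorem hasLaw_dotProduct_multivariateGaussian {p : ℕ} {A : Matrix (Fin p) (Fin p) ℝ}
    (hA : A.PosSemidef) (f : Fin p → ℝ) :
    HasLaw (fun x : EuclideanSpace ℝ (Fin p) => f ⬝ᵥ x.ofLp)
      (gaussianReal 0 (f ⬝ᵥ A.mulVec f).toNNReal) (multivariateGaussian 0 A) where
  map_eq := by
    have hnn : 0 ≤ f ⬝ᵥ A.mulVec f := by simpa using hA.dotProduct_mulVec_nonneg f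
    have hm : Measurable (fun x : EuclideanSpace ℝ (Fin p) => f ⬝ᵥ x.ofLp) := by
      unfold dotProduct; fun_prop
    have := Measure.isProbabilityMeasure_map (μ := multivariateGaussian 0 A) hm.aemeasurable
    refine Measure.ext_of_charFun (funext fun t => ?_)
    rw [charFun_gaussianReal, charFun_apply_real, integral_map hm.aemeasurable (by fun_prop)]
    have h := charFun_multivariateGaussian (μ := 0) hA (WithLp.toLp 2 (t • f))
    rw [charFun_apply] at h
    convert h using 1
    · congr 1; ext x; congr 2
      simp [PiLp.inner_apply, dotProduct, Finset.mul_sum]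
      ring_nf
    · simp [Matrix.mulVec_smul, hnn]
      ring_nf

/-- If `wᵀAw = 1`, the functional `w ⬝ x` of `x ∼ 𝒩(0, A)` is standard normal and independent of
`x - (w ⬝ x) A w`, so replacing its value by an independent standard normal `z` keeps the law. -/
theorem measurePreserving_resample {p : ℕ} {A : Matrix (Fin p) (Fin p) ℝ}
    (hA : A.PosSemidef) {w : Fin p → ℝ} (hw : w ⬝ᵥ A.mulVec w = 1) :
    MeasurePreserving
      (fun y : EuclideanSpace ℝ (Fin p) × ℝ =>
        y.1 + (y.2 - w ⬝ᵥ y.1.ofLp) • WithLp.toLp 2 (A.mulVec w))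
      ((multivariateGaussian 0 A).prod (gaussianReal 0 1)) (multivariateGaussian 0 A) := by
  have hm : Measurable (fun y : EuclideanSpace ℝ (Fin p) × ℝ =>
        y.1 + (y.2 - w ⬝ᵥ y.1.ofLp) • WithLp.toLp 2 (A.mulVec w)) := by
    unfold dotProduct; fun_prop
  refine ⟨hm, ?_⟩
  have := Measure.isProbabilityMeasure_map
    (μ := (multivariateGaussian 0 A).prod (gaussianReal 0 1)) hm.aemeasurable
  refine Measure.ext_of_charFun (funext fun t => ?_)
  rw [charFun_apply, integral_map hm.aemeasurable (by fun_prop),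
    charFun_multivariateGaussian hA]
  set β : ℝ := t.ofLp ⬝ᵥ A.mulVec w with hβ
  have hsymm : w ⬝ᵥ A.mulVec t.ofLp = β := by
    rw [hβ, Matrix.dotProduct_mulVec, ← Matrix.mulVec_transpose, dotProduct_comm]
    congr 2
    simpa using hA.isHermitian.eq
  have key : ∀ y : EuclideanSpace ℝ (Fin p) × ℝ,
      Complex.exp (↑(inner ℝ (y.1 + (y.2 - w ⬝ᵥ y.1.ofLp) • WithLp.toLp 2 (A.mulVec w)) t)
        * Complex.I) =
      Complex.exp (↑(inner ℝ y.1 (WithLp.toLp 2 (t.ofLp - β • w))) * Complex.I) *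
      Complex.exp (↑(β * y.2) * Complex.I) := by
    intro y
    rw [← Complex.exp_add]
    congr 1
    rw [← add_mul, ← Complex.ofReal_add]
    congr 2
    rw [inner_add_left, inner_smul_left]
    have h1 : inner ℝ (WithLp.toLp 2 (A.mulVec w) : EuclideanSpace ℝ (Fin p)) t = β := by
      simp [PiLp.inner_apply, hβ, dotProduct]
    have h2 : inner ℝ y.1 (WithLp.toLp 2 (t.ofLp - β • w)) =
        inner ℝ y.1 t - β * (w ⬝ᵥ y.1.ofLp) := by
      simp [PiLp.inner_apply, dotProduct, Finset.mul_sum, sub_mul, mul_assoc]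
    rw [h1, h2]
    simp
    ring
  simp_rw [key]
  rw [integral_prod_mul (f := fun x : EuclideanSpace ℝ (Fin p) =>
    Complex.exp (↑(inner ℝ x (WithLp.toLp 2 (t.ofLp - β • w))) * Complex.I))
    (g := fun z : ℝ => Complex.exp (↑(β * z) * Complex.I)), ← charFun_apply,
    charFun_multivariateGaussian hA]
  have h3 := charFun_gaussianReal (μ := 0) (v := 1) β
  rw [charFun_apply_real] at h3
  simp only [Complex.ofReal_mul]
  rw [h3, ← Complex.exp_add]
  congr 1
  simp [Matrix.mulVec_sub, Matrix.mulVec_smul, sub_dotProduct, dotProduct_sub, hw, hsymm, ← hβ]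
  ring

/-- Moves each sample `x n` along the direction `A (w n)` so that, when `(w n)ᵀ A (w n) = 1`, the
functional `w n` takes the new value `z n`. A sample with `w n = 0` is left alone. -/
noncomputable def resample {p N : ℕ} (A : Matrix (Fin p) (Fin p) ℝ) (w : Fin N → Fin p → ℝ)
    (y : (Fin N → EuclideanSpace ℝ (Fin p)) × (Fin N → ℝ)) : Fin N → EuclideanSpace ℝ (Fin p) :=
  fun n => y.1 n + (y.2 n - w n ⬝ᵥ (y.1 n).ofLp) • WithLp.toLp 2 (A.mulVec (w n))

theorem measurePreserving_resample_pi {p N : ℕ} {A : Matrix (Fin p) (Fin p) ℝ}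
    (hA : A.PosSemidef) {w : Fin N → Fin p → ℝ}
    (hw : ∀ n, w n ⬝ᵥ A.mulVec (w n) = 1 ∨ w n = 0) :
    MeasurePreserving (resample A w)
      ((Measure.pi fun _ : Fin N => multivariateGaussian 0 A).prod
        (Measure.pi fun _ : Fin N => gaussianReal 0 1))
      (Measure.pi fun _ : Fin N => multivariateGaussian 0 A) := by
  have h1 := (measurePreserving_arrowProdEquivProdArrow (EuclideanSpace ℝ (Fin p)) ℝ (Fin N)
    (fun _ => multivariateGaussian 0 A) (fun _ => gaussianReal 0 1)).symm
  have h2 := measurePreserving_pi (fun _ : Fin N => (multivariateGaussian 0 A).prod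
    (gaussianReal 0 1)) (fun _ => multivariateGaussian 0 A)
    (f := fun n y => y.1 + (y.2 - w n ⬝ᵥ y.1.ofLp) • WithLp.toLp 2 (A.mulVec (w n))) (by
      intro n
      rcases hw n with h | h
      · exact measurePreserving_resample hA h
      · simpa [h] using measurePreserving_fst (μ := multivariateGaussian 0 A)
          (ν := gaussianReal 0 1))
  exact h2.comp h1

/-- The probability that a standard Gaussian variable exceeds `-1`. -/
noncomputable def gaussianUpper : ℝ := (gaussianReal 0 1).real (Set.Ioi (-1))

theorem gaussianUpper_pos : 0 < gaussianUpper := by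
  unfold gaussianUpper
  have h : gaussianReal 0 1 (Set.Ioi (-1)) ≠ 0 := by
    have := gaussianReal_absolutelyContinuous' 0 (one_ne_zero : (1 : NNReal) ≠ 0)
    intro h0
    have := this h0
    simp at this
  exact ENNReal.toReal_pos h (measure_ne_top _ _)

theorem gaussianUpper_lt_one : gaussianUpper < 1 := by
  have h : gaussianReal 0 1 (Set.Iic (-1)) ≠ 0 := by
    have := gaussianReal_absolutelyContinuous' 0 (one_ne_zero : (1 : NNReal) ≠ 0)
    intro h0
    have := this h0
    simp at this
  have h1 : 0 < (gaussianReal 0 1).real (Set.Iic (-1)) :=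
    ENNReal.toReal_pos h (measure_ne_top _ _)
  have h2 := probReal_compl_eq_one_sub (μ := gaussianReal 0 1) (s := Set.Iic (-1)) measurableSet_Iic
  rw [Set.compl_Iic] at h2
  unfold gaussianUpper
  linarith

/-- A centred Gaussian shifted by at most one standard deviation is positive with probability
bounded away from one. The degenerate case `v = 0` is included: then `m ≤ 0`. -/
theorem gaussianReal_add_pos_le {m : ℝ} {v : NNReal} (hm : m ≤ √v) :
    (gaussianReal 0 v).real {y | 0 < m + y} ≤ gaussianUpper := by
  rcases eq_or_ne v 0 with rfl | hv
  · have : ¬ (0 < m) := by simpa using hm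
    have h0 : (0 : ℝ) ∉ {y : ℝ | 0 < m + y} := by simpa using this
    rw [gaussianReal_zero_var, Measure.real, Measure.dirac_apply' _ (by measurability)]
    simp only [Set.indicator_of_notMem h0]
    simpa using gaussianUpper_pos.le
  · have hmap := gaussianReal_map_const_mul (μ := 0) (v := 1) (√v)
    -- The variance that `gaussianReal_map_const_mul` produces, as an element of `ℝ≥0`.
    have hs : (⟨√(v:ℝ) ^ 2, sq_nonneg _⟩ : NNReal) * 1 = v := by
      ext; simp
    have hpos : (0 : ℝ) < √v := Real.sqrt_pos.2 (by positivity)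
    rw [mul_zero] at hmap
    erw [hs] at hmap
    rw [← hmap, map_measureReal_apply (by fun_prop) (by measurability)]
    unfold gaussianUpper
    refine measureReal_mono ?_
    intro z hz
    simp only [Set.mem_preimage, Set.mem_ofPred_eq] at hz
    simp only [Set.mem_Ioi]
    nlinarith

theorem gaussianReal_Ioi_le {t κ : ℝ} {v : NNReal} (ht : 0 ≤ t) (h : κ * v ≤ t ^ 2) :
    (gaussianReal 0 v).real {y | t < y} ≤ Real.exp (-κ / 2) := by
  rcases eq_or_ne v 0 with rfl | hv
  · have h0 : (0 : ℝ) ∉ {y : ℝ | t < y} := by simpa using ht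
    rw [gaussianReal_zero_var, Measure.real, Measure.dirac_apply' _ (by measurability)]
    simp only [Set.indicator_of_notMem h0]
    simpa using (Real.exp_pos _).le
  · have hv' : (0 : ℝ) < v := by positivity
    have h1 := measure_ge_le_exp_mul_mgf (μ := gaussianReal 0 v) (X := id) (t := t / v) t
      (by positivity) (integrable_exp_mul_gaussianReal _)
    rw [mgf_id_gaussianReal, ← Real.exp_add] at h1
    refine (measureReal_mono (fun y (hy : t < y) => hy.le)).trans (h1.trans ?_)
    rw [Real.exp_le_exp]
    have : -(t / v) * t + (0 * (t / v) + v * (t / v) ^ 2 / 2) = - (t ^ 2 / v) / 2 := by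
      field_simp; ring
    rw [this]
    have : κ ≤ t ^ 2 / v := by rw [le_div_iff₀ hv']; exact h
    linarith

theorem hasGaussianLaw_pi_gaussianReal (N : ℕ) :
    HasGaussianLaw (fun (z : Fin N → ℝ) n => z n) (Measure.pi fun _ : Fin N => gaussianReal 0 1) := by
  refine iIndepFun.hasGaussianLaw (fun n => ?_) (iIndepFun_pi (X := fun _ x => x) (by fun_prop))
  exact ((measurePreserving_eval (fun _ : Fin N => gaussianReal 0 1) n).hasLaw).hasGaussianLaw

theorem covariance_pi_gaussianReal {N : ℕ} (n m : Fin N) :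
    cov[fun z : Fin N → ℝ => z n, fun z => z m; Measure.pi fun _ : Fin N => gaussianReal 0 1] =
      if n = m then 1 else 0 := by
  have hl := fun n => (measurePreserving_eval (fun _ : Fin N => gaussianReal 0 1) n).hasLaw
  split_ifs with h
  · subst h
    rw [covariance_self (Measurable.aemeasurable (by fun_prop))]
    simpa using (hl n).variance_eq
  · refine IndepFun.covariance_eq_zero ?_ ?_ ?_
    · exact (iIndepFun_pi (μ := fun _ : Fin N => gaussianReal 0 1) (X := fun _ x => x)
        (by fun_prop)).indepFun h
    · exact (hl n).hasGaussianLaw.memLp_two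
    · exact (hl m).hasGaussianLaw.memLp_two

theorem covariance_sum_pi_gaussianReal {N : ℕ} (a b : Fin N → ℝ) :
    cov[fun z : Fin N → ℝ => ∑ n, a n * z n, fun z => ∑ n, b n * z n;
      Measure.pi fun _ : Fin N => gaussianReal 0 1] = ∑ n, a n * b n := by
  have hl : ∀ n, MemLp (fun z : Fin N → ℝ => z n) 2 (Measure.pi fun _ : Fin N => gaussianReal 0 1) :=
    fun n => (measurePreserving_eval (fun _ : Fin N => gaussianReal 0 1)
      n).hasLaw.hasGaussianLaw.memLp_two
  rw [covariance_fun_sum_fun_sum (fun n => (hl n).const_mul _) (fun n => (hl n).const_mul _)]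
  simp [covariance_const_mul_left, covariance_const_mul_right, covariance_pi_gaussianReal, mul_comm]

theorem hasLaw_sum_pi_gaussianReal {N : ℕ} (a : Fin N → ℝ) :
    HasLaw (fun z : Fin N → ℝ => ∑ n, a n * z n) (gaussianReal 0 (∑ n, a n ^ 2).toNNReal)
      (Measure.pi fun _ : Fin N => gaussianReal 0 1) where
  aemeasurable := Measurable.aemeasurable (by fun_prop)
  map_eq := by
    have hg : HasGaussianLaw (fun z : Fin N → ℝ => ∑ n, a n * z n)
        (Measure.pi fun _ : Fin N => gaussianReal 0 1) := by
      have := (hasGaussianLaw_pi_gaussianReal N).map_fun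
        (∑ n, a n • ContinuousLinearMap.proj (R := ℝ) (φ := fun _ : Fin N => ℝ) n)
      simpa using this
    rw [hg.map_eq_gaussianReal]
    have hl := fun n => (measurePreserving_eval (fun _ : Fin N => gaussianReal 0 1) n).hasLaw
    congr 1
    · rw [integral_finsetSum _ (fun n _ => ((hl n).hasGaussianLaw.integrable).const_mul _)]
      refine Finset.sum_eq_zero fun n _ => ?_
      rw [integral_const_mul]
      have := (hl n).integral_eq
      simp at this
      simp [this]
    · rw [← covariance_self (Measurable.aemeasurable (by fun_prop)), covariance_sum_pi_gaussianReal]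
      simp [sq]

theorem iIndepFun_sum_pi_gaussianReal {N K : ℕ} (a : Fin K → Fin N → ℝ)
    (ha : ∀ k l, k ≠ l → ∑ n, a k n * a l n = 0) :
    iIndepFun (fun k (z : Fin N → ℝ) => ∑ n, a k n * z n)
      (Measure.pi fun _ : Fin N => gaussianReal 0 1) := by
  refine HasGaussianLaw.iIndepFun_of_covariance_eq_zero ?_ fun k l hkl => ?_
  · have := (hasGaussianLaw_pi_gaussianReal N).map_fun
      (ContinuousLinearMap.pi fun k =>
        ∑ n, a k n • ContinuousLinearMap.proj (R := ℝ) (φ := fun _ : Fin N => ℝ) n)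
    simpa using this
  · rw [covariance_sum_pi_gaussianReal, ha k l hkl]

/-! ### Sample regression residuals and the sign of the partial correlation -/

/-- The coefficients `c` of the residual `c ⬝ x` of coordinate `j` after least-squares regression,
without intercept, on the coordinates in `S`, computed from the samples of the batch `b`. Thus `c`
is `1` at `j`, minus the regression coefficients on `S`, and `0` elsewhere; the regression
coefficients are junk when the sample covariance matrix of `S` is singular. -/
noncomputable def residualCoeff {p N : ℕ} (x : Fin N → EuclideanSpace ℝ (Fin p))
    (b : Finset (Fin N)) (j : Fin p) (S : Finset (Fin p)) : Fin p → ℝ := fun a =>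
  if h : a ∈ S then
    -((principalSubmatrix (sampleCov x b) S)⁻¹.mulVec (fun s => sampleCov x b s j) ⟨a, h⟩)
  else if a = j then 1 else 0

section
variable {p N : ℕ} {x : Fin N → EuclideanSpace ℝ (Fin p)} {b : Finset (Fin N)} {i j : Fin p}
  {S : Finset (Fin p)}

/-- The residual coefficients see only the coordinates `S ∪ {j}` of the samples in the batch. -/
theorem residualCoeff_congr {x' : Fin N → EuclideanSpace ℝ (Fin p)}
    (h : ∀ n ∈ b, ∀ a ∈ insert j S, x n a = x' n a) :
    residualCoeff x b j S = residualCoeff x' b j S := by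
  have h1 : ∀ a ∈ insert j S, ∀ c ∈ insert j S, sampleCov x b a c = sampleCov x' b a c := by
    intro a ha c hc
    simp only [sampleCov, Matrix.of_apply]
    congr 1
    exact Finset.sum_congr rfl fun n hn => by rw [h n hn a ha, h n hn c hc]
  have h2 : principalSubmatrix (sampleCov x b) S = principalSubmatrix (sampleCov x' b) S := by
    ext s t
    exact h1 s (Finset.mem_insert_of_mem s.2) t (Finset.mem_insert_of_mem t.2)
  have h3 : (fun s : S => sampleCov x b s j) = fun s : S => sampleCov x' b s j := by
    ext s
    exact h1 s (Finset.mem_insert_of_mem s.2) j (Finset.mem_insert_self _ _)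
  unfold residualCoeff
  rw [h2, h3]

theorem residualCoeff_of_notMem {a : Fin p} (ha : a ∉ insert j S) :
    residualCoeff x b j S a = 0 := by
  simp only [Finset.mem_insert, not_or] at ha
  simp [residualCoeff, ha.1, ha.2]

theorem residualCoeff_self (hj : j ∉ S) : residualCoeff x b j S j = 1 := by
  simp [residualCoeff, hj]

theorem measurable_sampleCov (b : Finset (Fin N)) (a c : Fin p) :
    Measurable fun x : Fin N → EuclideanSpace ℝ (Fin p) => sampleCov x b a c := by
  simp only [sampleCov, Matrix.of_apply]
  fun_prop

theorem Measurable.matrix_inv_apply {ι Ω : Type*} [Fintype ι] [DecidableEq ι] [MeasurableSpace Ω]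
    {f : Ω → Matrix ι ι ℝ} (hf : ∀ r s, Measurable fun ω => f ω r s) (r s : ι) :
    Measurable fun ω => (f ω)⁻¹ r s := by
  have hF : Measurable fun ω => (fun r s => f ω r s : ι → ι → ℝ) :=
    measurable_pi_lambda _ fun r => measurable_pi_lambda _ fun s => hf r s
  have hdet : Continuous fun A : ι → ι → ℝ => (Matrix.of A).det :=
    Continuous.matrix_det continuous_id
  have hadj : Continuous fun A : ι → ι → ℝ => (Matrix.of A).adjugate r s :=
    (Continuous.matrix_adjugate (A := fun A : ι → ι → ℝ => Matrix.of A)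
      continuous_id).matrix_elem r s
  have : (fun ω => (f ω)⁻¹ r s) = fun ω => ((f ω).det)⁻¹ * (f ω).adjugate r s := by
    ext ω; simp [Matrix.inv_def]
  rw [this]
  exact ((hdet.measurable.comp hF).inv).mul (hadj.measurable.comp hF)

theorem measurable_residualCoeff (b : Finset (Fin N)) (j : Fin p) (S : Finset (Fin p))
    (a : Fin p) : Measurable fun x : Fin N → EuclideanSpace ℝ (Fin p) =>
      residualCoeff x b j S a := by
  unfold residualCoeff
  split_ifs with h1 h2
  · simp only [Matrix.mulVec, dotProduct]
    refine (Finset.measurable_sum _ fun s _ => ?_).neg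
    exact (Measurable.matrix_inv_apply
      (f := fun x : Fin N → EuclideanSpace ℝ (Fin p) => principalSubmatrix (sampleCov x b) S)
      (fun r s => measurable_sampleCov b (r : Fin p) (s : Fin p)) _ _).mul (measurable_sampleCov b _ _)
  · exact measurable_const
  · exact measurable_const

theorem sampleCov_mulVec (x : Fin N → EuclideanSpace ℝ (Fin p)) (b : Finset (Fin N))
    (f : Fin p → ℝ) (a : Fin p) :
    (sampleCov x b).mulVec f a = (b.card : ℝ)⁻¹ * ∑ n ∈ b, (f ⬝ᵥ (x n).ofLp) * x n a := by
  simp only [Matrix.mulVec, dotProduct, sampleCov, Matrix.of_apply, Finset.sum_mul,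
    mul_assoc, Finset.mul_sum]
  rw [Finset.sum_comm]
  refine Finset.sum_congr rfl fun n _ => Finset.sum_congr rfl fun c _ => by ring

theorem posSemidef_sampleCov (x : Fin N → EuclideanSpace ℝ (Fin p)) (b : Finset (Fin N)) :
    (sampleCov x b).PosSemidef := by
  refine Matrix.PosSemidef.of_dotProduct_mulVec_nonneg ?_ fun f => ?_
  · ext a c
    simp [sampleCov, mul_comm]
  · have : star f ⬝ᵥ (sampleCov x b).mulVec f =
        (b.card : ℝ)⁻¹ * ∑ n ∈ b, (f ⬝ᵥ (x n).ofLp) ^ 2 := by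
      simp only [dotProduct, sampleCov_mulVec, star_trivial]
      simp only [Finset.mul_sum, sq]
      rw [Finset.sum_comm]
      refine Finset.sum_congr rfl fun n _ => ?_
      simp only [Finset.mul_sum, Finset.sum_mul]
      refine Finset.sum_congr rfl fun n _ => Finset.sum_congr rfl fun m _ => by ring
    rw [this]
    positivity

theorem principalSubmatrix_mulVec {A : Matrix (Fin p) (Fin p) ℝ} {Q : Finset (Fin p)}
    {f : Fin p → ℝ} (hf : ∀ a ∉ Q, f a = 0) (a : Q) :
    (principalSubmatrix A Q).mulVec (fun c => f c) a = A.mulVec f a := by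
  simp only [Matrix.mulVec, dotProduct, principalSubmatrix, Matrix.submatrix_apply]
  rw [Finset.sum_coe_sort Q (fun c => A a c * f c)]
  exact Finset.sum_subset (Finset.subset_univ _) fun c _ hc => by rw [hf c hc, mul_zero]

theorem sampleCov_mulVec_residualCoeff (hj : j ∉ S)
    (hS : IsUnit (principalSubmatrix (sampleCov x b) S).det) {a : Fin p} (ha : a ∈ S) :
    (sampleCov x b).mulVec (residualCoeff x b j S) a = 0 := by
  set H := sampleCov x b
  set h : S → ℝ := fun s => H s j with hh
  have h1 : H.mulVec (residualCoeff x b j S) a =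
      ∑ c ∈ insert j S, H a c * residualCoeff x b j S c := by
    refine (Finset.sum_subset (Finset.subset_univ (insert j S)) fun c _ hc => ?_).symm
    rw [residualCoeff_of_notMem hc, mul_zero]
  rw [h1, Finset.sum_insert hj, residualCoeff_self hj,
    ← Finset.sum_coe_sort S (fun c => H a c * residualCoeff x b j S c)]
  have h2 : ∑ s : S, H a s * residualCoeff x b j S s =
      -((principalSubmatrix H S).mulVec ((principalSubmatrix H S)⁻¹.mulVec h) ⟨a, ha⟩) := by
    simp only [residualCoeff, Finset.coe_mem, dite_true, Subtype.coe_eta, mul_neg,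
      Finset.sum_neg_distrib]
    rfl
  rw [h2, Matrix.mulVec_mulVec, Matrix.mul_nonsing_inv _ hS, Matrix.one_mulVec]
  simp [h]

/-- A positive sample partial correlation forces the sample covariance matrix `H` of `S ∪ {i, j}`
to be invertible. Writing `c` for the residual coefficients, `(H c)` vanishes on `S` and is
positive at `j`, and the row `i` of `H⁻¹ (H c) = c` reads `(H⁻¹)ᵢᵢ (H c)ᵢ + (H⁻¹)ᵢⱼ (H c)ⱼ = 0`;
so `(H⁻¹)ᵢⱼ < 0` gives `(H c)ᵢ > 0`. -/
theorem residual_of_partialCorr_pos (hij : i ≠ j) (hi : i ∉ S) (hj : j ∉ S)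
    (hpos : 0 < partialCorr (sampleCov x b) i j S) :
    (∀ a ∈ S, ∑ n ∈ b, (residualCoeff x b j S ⬝ᵥ (x n).ofLp) * x n a = 0) ∧
      0 < ∑ n ∈ b, (residualCoeff x b j S ⬝ᵥ (x n).ofLp) * x n i := by
  set H := sampleCov x b with hH
  set Q := insert i (insert j S) with hQ
  set c := residualCoeff x b j S with hc
  have hiQ : i ∈ Q := by simp [Q]
  have hjQ : j ∈ Q := by simp [Q]
  have hci : c i = 0 := residualCoeff_of_notMem (by simp [hij, hi])
  have hcj : c j = 1 := residualCoeff_self hj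
  have hcQ : ∀ a ∉ Q, c a = 0 := fun a ha => residualCoeff_of_notMem
    fun h => ha (Finset.mem_insert_of_mem h)
  set HQ := principalSubmatrix H Q with hHQ
  set i' : Q := ⟨i, hiQ⟩
  set j' : Q := ⟨j, hjQ⟩
  have hij' : i' ≠ j' := by simpa [i', j'] using hij
  have hpc : partialCorr H i j S = -(HQ⁻¹ i' j') / √(HQ⁻¹ i' i' * HQ⁻¹ j' j') := rfl
  -- In the singular case the inverse is `0`, and the partial correlation would be `0`.
  have hunit : IsUnit HQ.det := by
    by_contra hn
    rw [hpc, Matrix.nonsing_inv_apply_not_isUnit _ hn] at hpos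
    simp at hpos
  have hpsd : HQ.PosSemidef := (posSemidef_sampleCov x b).submatrix _
  have hpd : HQ.PosDef := hpsd.posDef_iff_isUnit.2 ((Matrix.isUnit_iff_isUnit_det _).2 hunit)
  have hSunit : IsUnit (principalSubmatrix H S).det := by
    have : (principalSubmatrix H S).PosDef := by
      refine hpd.submatrix (e := fun s : S => (⟨s, by simp [Q]⟩ : Q)) ?_
      intro s t hst
      exact Subtype.ext (congrArg (fun a : Q => (a : Fin p)) hst)
    exact (Matrix.isUnit_iff_isUnit_det _).1 this.isUnit
  have horth : ∀ a ∈ S, H.mulVec c a = 0 := fun a ha => sampleCov_mulVec_residualCoeff hj hSunit ha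
  have hHc : HQ.mulVec (fun a : Q => c a) = fun a : Q => H.mulVec c a :=
    funext fun a => principalSubmatrix_mulVec hcQ a
  have hcases : ∀ a : Q, a ≠ i' ∧ a ≠ j' → (a : Fin p) ∈ S := by
    rintro ⟨a, ha⟩ ⟨h1, h2⟩
    have h1' : a ≠ i := fun h => h1 (Subtype.ext h)
    have h2' : a ≠ j := fun h => h2 (Subtype.ext h)
    simpa [Q, h1', h2'] using ha
  have hHcj : 0 < H.mulVec c j := by
    have h1 := hpd.dotProduct_mulVec_pos (x := fun a => c a) (fun h => by
      have := congrFun h j'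
      simp [j', hcj] at this)
    rw [hHc] at h1
    simp only [dotProduct, star_trivial, Pi.star_apply] at h1
    rw [Fintype.sum_eq_add i' j' hij' (fun a ha => by rw [horth a (hcases a ha), mul_zero])] at h1
    simpa [i', j', hci, hcj] using h1
  have hrel : HQ⁻¹ i' i' * H.mulVec c i + HQ⁻¹ i' j' * H.mulVec c j = 0 := by
    have h1 : HQ⁻¹.mulVec (HQ.mulVec fun a => c a) i' = 0 := by
      rw [Matrix.mulVec_mulVec, Matrix.nonsing_inv_mul _ hunit, Matrix.one_mulVec]
      exact hci
    rw [hHc] at h1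
    simp only [Matrix.mulVec, dotProduct] at h1
    rw [Fintype.sum_eq_add i' j' hij' (fun a ha => by
      have := horth a (hcases a ha)
      simp only [Matrix.mulVec, dotProduct] at this
      rw [this, mul_zero])] at h1
    exact h1
  have hg : 0 < HQ⁻¹ i' i' := hpd.inv.diag_pos
  have hneg : HQ⁻¹ i' j' < 0 := by
    rw [hpc] at hpos
    by_contra hn
    push Not at hn
    exact absurd hpos (not_lt.2 (div_nonpos_of_nonpos_of_nonneg (by linarith) (Real.sqrt_nonneg _)))
  have hHci : 0 < H.mulVec c i := by
    by_contra hn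
    push Not at hn
    nlinarith
  have hcard : (0 : ℝ) < (b.card : ℝ)⁻¹ := by
    rcases (b.card).eq_zero_or_pos with h | h
    · rw [hH, sampleCov_mulVec, h] at hHci
      simp at hHci
    · positivity
  constructor
  · intro a ha
    have := horth a ha
    rw [hH, sampleCov_mulVec] at this
    exact (mul_eq_zero.1 this).resolve_left hcard.ne'
  · rw [hH, sampleCov_mulVec] at hHci
    exact (pos_iff_pos_of_mul_pos hHci).1 hcard

/-- The normalized column `i` of the inverse of the principal submatrix on `S ∪ {i, j}`. Vanishing
of the partial correlation removes `j` from its support; moving along `A w` changes no coordinate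
in `S ∪ {j}`. -/
theorem exists_resampling_direction {A : Matrix (Fin p) (Fin p) ℝ} (hA : A.PosDef)
    (hpc : partialCorr A i j S = 0) :
    ∃ w : Fin p → ℝ, w ⬝ᵥ A.mulVec w = 1 ∧ 0 < w i ∧ (∀ a ∉ insert i S, w a = 0) ∧
      (i ∉ S → i ≠ j → ∀ a ∈ insert j S, A.mulVec w a = 0) := by
  set Q := insert i (insert j S) with hQ
  have hiQ : i ∈ Q := by simp [Q]
  have hjQ : j ∈ Q := by simp [Q]
  set AQ := principalSubmatrix A Q with hAQ
  set i' : Q := ⟨i, hiQ⟩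
  set j' : Q := ⟨j, hjQ⟩
  have hpd : AQ.PosDef := hA.submatrix Subtype.val_injective
  have hunit : IsUnit AQ.det := (Matrix.isUnit_iff_isUnit_det _).1 hpd.isUnit
  have hii : 0 < AQ⁻¹ i' i' := hpd.inv.diag_pos
  have hjj : 0 < AQ⁻¹ j' j' := hpd.inv.diag_pos
  have h0 : AQ⁻¹ j' i' = 0 := by
    have h1 : -(AQ⁻¹ i' j') / √(AQ⁻¹ i' i' * AQ⁻¹ j' j') = 0 := hpc
    have h2 : √(AQ⁻¹ i' i' * AQ⁻¹ j' j') ≠ 0 := (Real.sqrt_pos.2 (mul_pos hii hjj)).ne'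
    have h3 : AQ⁻¹ i' j' = 0 := by
      rcases div_eq_zero_iff.1 h1 with h | h
      · linarith
      · exact absurd h h2
    have := hpd.inv.isHermitian.apply i' j'
    simpa [h3] using this
  set r := √(AQ⁻¹ i' i') with hr
  have hrpos : 0 < r := Real.sqrt_pos.2 hii
  set w : Fin p → ℝ := fun a => if h : a ∈ Q then AQ⁻¹ ⟨a, h⟩ i' / r else 0 with hw
  have hwQ : ∀ a ∉ Q, w a = 0 := fun a ha => by simp [hw, ha]
  have hAw : ∀ a : Q, A.mulVec w a = if a = i' then r⁻¹ else 0 := by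
    intro a
    rw [← principalSubmatrix_mulVec hwQ a]
    have h1 : (AQ * AQ⁻¹) a i' = if a = i' then 1 else 0 := by
      rw [Matrix.mul_nonsing_inv _ hunit, Matrix.one_apply]
    rw [Matrix.mul_apply] at h1
    simp only [Matrix.mulVec, dotProduct, hw, Finset.coe_mem, dite_true, Subtype.coe_eta,
      mul_div_assoc', ← Finset.sum_div]
    rw [h1]
    split_ifs <;> simp
  have hwi : w i = r := by
    simp only [hw, hiQ, dite_true]
    rw [div_eq_iff hrpos.ne', hr, Real.mul_self_sqrt hii.le]
  refine ⟨w, ?_, by rw [hwi]; exact hrpos, ?_, ?_⟩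
  · have h1 : w ⬝ᵥ A.mulVec w = ∑ a : Q, w a * A.mulVec w a := by
      rw [Finset.sum_coe_sort Q (fun a => w a * A.mulVec w a)]
      exact (Finset.sum_subset (Finset.subset_univ _) fun c _ hc => by
        rw [hwQ c hc, zero_mul]).symm
    rw [h1, Finset.sum_eq_single i' (fun a _ ha => by rw [hAw, if_neg ha, mul_zero]) (by simp),
      hAw, if_pos rfl, hwi, mul_inv_cancel₀ hrpos.ne']
  · intro a ha
    by_cases haQ : a ∈ Q
    · have : a = j := by simp [Q] at haQ ha; tauto
      subst this
      simp only [hw, hjQ, dite_true]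
      rw [h0, zero_div]
    · exact hwQ a haQ
  · intro hi hij a ha
    rw [hAw ⟨a, Finset.mem_insert_of_mem ha⟩, if_neg]
    intro h
    have : a = i := congrArg Subtype.val h
    subst this
    simp [hij, hi] at ha
end

/-! ### Conditioning on everything but the private parts of the batches -/

/-- The residual of coordinate `j` of sample `n` after regression on the coordinates in `S` within
the batch `b`. -/
noncomputable def sampleResidual {p N : ℕ} (x : Fin N → EuclideanSpace ℝ (Fin p))
    (b : Finset (Fin N)) (j : Fin p) (S : Finset (Fin p)) (n : Fin N) : ℝ :=
  residualCoeff x b j S ⬝ᵥ (x n).ofLp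

section
variable {p N : ℕ} {x : Fin N → EuclideanSpace ℝ (Fin p)} {b : Finset (Fin N)} {i j : Fin p}
  {S : Finset (Fin p)}

theorem measurable_dotProduct_sample (w : Fin p → ℝ) (n : Fin N) :
    Measurable fun x : Fin N → EuclideanSpace ℝ (Fin p) => w ⬝ᵥ (x n).ofLp := by
  unfold dotProduct; fun_prop

theorem measurable_sampleResidual (b : Finset (Fin N)) (j : Fin p) (S : Finset (Fin p)) (n : Fin N) :
    Measurable fun x : Fin N → EuclideanSpace ℝ (Fin p) => sampleResidual x b j S n := by
  unfold sampleResidual dotProduct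
  exact Finset.measurable_sum _ fun a _ => (measurable_residualCoeff b j S a).mul (by fun_prop)

/-- The residuals are orthogonal to the coordinates in `S`, so only the coordinate `i` of the
functional `w` contributes to the sum. -/
theorem sum_sampleResidual_mul_pos {w : Fin p → ℝ} (hij : i ≠ j) (hi : i ∉ S) (hj : j ∉ S)
    (hwi : 0 < w i) (hw : ∀ a ∉ insert i S, w a = 0)
    (hpos : 0 < partialCorr (sampleCov x b) i j S) :
    0 < ∑ n ∈ b, sampleResidual x b j S n * (w ⬝ᵥ (x n).ofLp) := by
  obtain ⟨h1, h2⟩ := residual_of_partialCorr_pos hij hi hj hpos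
  have h3 : ∑ n ∈ b, sampleResidual x b j S n * (w ⬝ᵥ (x n).ofLp) =
      ∑ a, w a * ∑ n ∈ b, sampleResidual x b j S n * x n a := by
    simp only [dotProduct, Finset.mul_sum]
    rw [Finset.sum_comm]
    exact Finset.sum_congr rfl fun a _ => Finset.sum_congr rfl fun n _ => by ring
  rw [h3, Finset.sum_eq_single i]
  · exact mul_pos hwi h2
  · intro a _ ha
    by_cases haS : a ∈ S
    · unfold sampleResidual
      rw [h1 a haS, mul_zero]
    · rw [hw a (by simp [ha, haS]), zero_mul]
  · simp

section resample
variable {A : Matrix (Fin p) (Fin p) ℝ} {W : Fin N → Fin p → ℝ} {w : Fin p → ℝ}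
  {D : Finset (Fin N)} {z : Fin N → ℝ}

theorem resample_apply_of_mulVec_eq_zero {n : Fin N} {a : Fin p} (h : A.mulVec (W n) a = 0) :
    resample A W (x, z) n a = x n a := by
  simp [resample, h]

/-- Resampling along `A w` does not touch the coordinates `S ∪ {j}`, hence neither the residual
coefficients. -/
theorem residualCoeff_resample (hwS : ∀ a ∈ insert j S, A.mulVec w a = 0)
    (hW : ∀ n ∈ b, W n = w ∨ W n = 0) :
    residualCoeff (resample A W (x, z)) b j S = residualCoeff x b j S := by
  refine residualCoeff_congr fun n hn a ha => resample_apply_of_mulVec_eq_zero ?_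
  rcases hW n hn with h | h
  · rw [h, hwS a ha]
  · simp [h]

theorem sampleResidual_resample (hwS : ∀ a ∈ insert j S, A.mulVec w a = 0)
    (hW : ∀ n ∈ b, W n = w ∨ W n = 0) {n : Fin N} (hn : n ∈ b) :
    sampleResidual (resample A W (x, z)) b j S n = sampleResidual x b j S n := by
  unfold sampleResidual
  rw [residualCoeff_resample hwS hW]
  refine Finset.sum_congr rfl fun a _ => ?_
  by_cases ha : a ∈ insert j S
  · rw [resample_apply_of_mulVec_eq_zero]
    rcases hW n hn with h | h
    · rw [h, hwS a ha]
    · simp [h]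
  · rw [residualCoeff_of_notMem ha, zero_mul, zero_mul]

theorem dotProduct_resample_of_eq (hw : w ⬝ᵥ A.mulVec w = 1) {n : Fin N} (hn : W n = w) :
    w ⬝ᵥ (resample A W (x, z) n).ofLp = z n := by
  simp [resample, hn, dotProduct_add, dotProduct_smul, hw]

theorem dotProduct_resample_of_eq_zero {n : Fin N} (hn : W n = 0) :
    w ⬝ᵥ (resample A W (x, z) n).ofLp = w ⬝ᵥ (x n).ofLp := by
  simp [resample, hn]

end resample
end

/-- Fubini for a bound on the sections that may fail over an exceptional set `B`. -/
theorem measureReal_prod_le_add {α β : Type*} [MeasurableSpace α] [MeasurableSpace β]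
    {μ : Measure α} {ν : Measure β} [IsProbabilityMeasure μ] [IsProbabilityMeasure ν]
    {F : Set (α × β)} (hF : MeasurableSet F) {B : Set α} (hB : MeasurableSet B) {r : ℝ}
    (hr : 0 ≤ r) (h : ∀ x ∉ B, ν.real {z | (x, z) ∈ F} ≤ r) :
    (μ.prod ν).real F ≤ r + μ.real B := by
  have h1 : (μ.prod ν) F ≤ ENNReal.ofReal r + μ B := by
    rw [Measure.prod_apply hF]
    calc ∫⁻ x, ν (Prod.mk x ⁻¹' F) ∂μ ≤ ∫⁻ x, (ENNReal.ofReal r + B.indicator 1 x) ∂μ := by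
          refine lintegral_mono fun x => ?_
          by_cases hx : x ∈ B
          · simp only [Set.indicator_of_mem hx, Pi.one_apply]
            exact prob_le_one.trans le_add_self
          · simp only [Set.indicator_of_notMem hx, add_zero]
            exact (ENNReal.le_ofReal_iff_toReal_le (measure_ne_top _ _) hr).2 (h x hx)
      _ = ENNReal.ofReal r + μ B := by
          rw [lintegral_add_left measurable_const, lintegral_indicator_one hB]
          simp
  have h2 := ENNReal.toReal_mono (by finiteness) h1
  rwa [ENNReal.toReal_add (by finiteness) (by finiteness), ENNReal.toReal_ofReal hr] at h2

theorem pi_gaussianReal_forall_pos_le {N K : ℕ} (a : Fin K → Fin N → ℝ)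
    (ha : ∀ k l, k ≠ l → ∑ n, a k n * a l n = 0) (m : Fin K → ℝ)
    (hm : ∀ k, m k ≤ √(∑ n, a k n ^ 2)) :
    (Measure.pi fun _ : Fin N => gaussianReal 0 1).real
      {z | ∀ k, 0 < m k + ∑ n, a k n * z n} ≤ gaussianUpper ^ K := by
  have hset : {z : Fin N → ℝ | ∀ k, 0 < m k + ∑ n, a k n * z n} =
      ⋂ k ∈ (Finset.univ : Finset (Fin K)),
        (fun z : Fin N → ℝ => ∑ n, a k n * z n) ⁻¹' {y | 0 < m k + y} := by
    ext z; simp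
  rw [hset, Measure.real, (iIndepFun_sum_pi_gaussianReal a ha).measure_inter_preimage_eq_mul
    Finset.univ (sets := fun k => {y | 0 < m k + y}) (fun k _ => by measurability),
    ENNReal.toReal_prod]
  calc _ ≤ ∏ _k : Fin K, gaussianUpper := by
        refine Finset.prod_le_prod (fun _ _ => ENNReal.toReal_nonneg) fun k _ => ?_
        have h1 := (hasLaw_sum_pi_gaussianReal (a k)).measureReal_eq
          (p := fun y => 0 < m k + y) (by measurability)
        refine le_trans (le_of_eq h1) (gaussianReal_add_pos_le ?_)
        rw [Real.coe_toNNReal _ (by positivity)]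
        exact hm k
    _ = gaussianUpper ^ K := by simp

section
variable {p N K : ℕ} {A : Matrix (Fin p) (Fin p) ℝ} {i j : Fin p}

/-- Suppose that the part `D k` of the batch `b k` meets no other batch. Resampling the functional
`w k` on `D k` turns the `k`-th statistic into a constant plus an independent centred Gaussian of
variance `∑ n ∈ D k, residual ^ 2`. The `K` events are then conditionally independent, and each
has probability at most `gaussianUpper` unless the contribution of `b k \ D k` exceeds one
standard deviation. -/
theorem measureReal_forall_stat_pos_le (hA : A.PosSemidef) {w : Fin K → Fin p → ℝ}
    {S : Fin K → Finset (Fin p)} (hw : ∀ k, w k ⬝ᵥ A.mulVec (w k) = 1)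
    (hwS : ∀ k, ∀ a ∈ insert j (S k), A.mulVec (w k) a = 0)
    {b D : Fin K → Finset (Fin N)} (hDb : ∀ k, D k ⊆ b k)
    (hdisj : ∀ k l, k ≠ l → Disjoint (D k) (b l)) :
    (Measure.pi fun _ : Fin N => multivariateGaussian 0 A).real
        {x | ∀ k, 0 < ∑ n ∈ b k, sampleResidual x (b k) j (S k) n * (w k ⬝ᵥ (x n).ofLp)} ≤
      gaussianUpper ^ K + ∑ k, (Measure.pi fun _ : Fin N => multivariateGaussian 0 A).real
        {x | √(∑ n ∈ D k, sampleResidual x (b k) j (S k) n ^ 2) <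
          ∑ n ∈ b k \ D k, sampleResidual x (b k) j (S k) n * (w k ⬝ᵥ (x n).ofLp)} := by
  classical
  set μ := Measure.pi fun _ : Fin N => multivariateGaussian 0 A
  set B : Fin K → Set (Fin N → EuclideanSpace ℝ (Fin p)) := fun k =>
    {x | √(∑ n ∈ D k, sampleResidual x (b k) j (S k) n ^ 2) <
          ∑ n ∈ b k \ D k, sampleResidual x (b k) j (S k) n * (w k ⬝ᵥ (x n).ofLp)} with hBdef
  have hmr := fun k n => measurable_sampleResidual (b k) j (S k) n
  have hmw := fun k (n : Fin N) => measurable_dotProduct_sample (w k) n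
  have hBm : ∀ k, MeasurableSet (B k) := fun k => measurableSet_lt
    (Finset.measurable_sum _ fun n _ => (hmr k n).pow_const 2).sqrt
    (Finset.measurable_sum _ fun n _ => (hmr k n).mul (hmw k n))
  have hEm : MeasurableSet {x : Fin N → EuclideanSpace ℝ (Fin p) |
      ∀ k, 0 < ∑ n ∈ b k, sampleResidual x (b k) j (S k) n * (w k ⬝ᵥ (x n).ofLp)} := by
    rw [Set.ofPred_forall]
    exact MeasurableSet.iInter fun k => measurableSet_lt measurable_const
      (Finset.measurable_sum _ fun n _ => (hmr k n).mul (hmw k n))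
  -- A sample in some `D k` is resampled along `w k`, every other sample is kept.
  set W : Fin N → Fin p → ℝ := fun n => if h : ∃ k, n ∈ D k then w h.choose else 0 with hWdef
  have hWD : ∀ k, ∀ n ∈ D k, W n = w k := by
    intro k n hn
    have h : ∃ k, n ∈ D k := ⟨k, hn⟩
    have : h.choose = k := by
      by_contra hne
      exact Finset.disjoint_left.1 (hdisj _ _ hne) h.choose_spec (hDb k hn)
    simp only [hWdef, h, dite_true, this]
  have hW0 : ∀ k, ∀ n ∈ b k, n ∉ D k → W n = 0 := by
    intro k n hn hnD
    have h : ¬ ∃ k, n ∈ D k := by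
      rintro ⟨l, hl⟩
      have hlk : l ≠ k := fun h => hnD (h ▸ hl)
      exact Finset.disjoint_left.1 (hdisj _ _ hlk) hl hn
    simp only [hWdef, h, dite_false]
  have hWb : ∀ k, ∀ n ∈ b k, W n = w k ∨ W n = 0 := fun k n hn => by
    by_cases h : n ∈ D k
    · exact Or.inl (hWD k n h)
    · exact Or.inr (hW0 k n hn h)
  have hmp := measurePreserving_resample_pi hA (w := W) (fun n => by
    by_cases h : ∃ k, n ∈ D k
    · obtain ⟨k, hk⟩ := h
      rw [hWD k n hk]
      exact Or.inl (hw k)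
    · right
      simp only [hWdef, h, dite_false])
  rw [← hmp.measureReal_preimage hEm.nullMeasurableSet]
  refine (measureReal_prod_le_add (B := ⋃ k, B k) (r := gaussianUpper ^ K)
    (hmp.measurable hEm) (MeasurableSet.iUnion hBm)
    (pow_nonneg gaussianUpper_pos.le _) ?_).trans
    (by gcongr; exact measureReal_iUnion_fintype_le _)
  intro x hx
  set a : Fin K → Fin N → ℝ := fun k n => if n ∈ D k then sampleResidual x (b k) j (S k) n else 0
  have hfib := pi_gaussianReal_forall_pos_le a (fun k l hkl => ?_)
    (fun k => ∑ n ∈ b k \ D k, sampleResidual x (b k) j (S k) n * (w k ⬝ᵥ (x n).ofLp)) (fun k => ?_)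
  · refine le_trans (le_of_eq ?_) hfib
    congr 1
    ext z
    simp only [Set.mem_preimage, Set.mem_ofPred_eq]
    refine forall_congr' fun k => ?_
    rw [← Finset.sum_sdiff (hDb k)]
    congr! 2
    · refine Finset.sum_congr rfl fun n hn => ?_
      rw [Finset.mem_sdiff] at hn
      rw [sampleResidual_resample (hwS k) (hWb k) hn.1,
        dotProduct_resample_of_eq_zero (hW0 k n hn.1 hn.2)]
    · simp only [a, ite_mul, zero_mul, Finset.sum_ite_mem, Finset.univ_inter]
      refine Finset.sum_congr rfl fun n hn => ?_
      rw [sampleResidual_resample (hwS k) (hWb k) (hDb k hn), dotProduct_resample_of_eq (hw k)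
        (hWD k n hn)]
  · refine Finset.sum_eq_zero fun n _ => ?_
    by_cases h : n ∈ D k
    · have : n ∉ D l := fun h' => Finset.disjoint_left.1 (hdisj k l hkl) h (hDb l h')
      simp [a, this]
    · simp [a, h]
  · have h1 : x ∉ B k := fun h => hx (Set.mem_iUnion.2 ⟨k, h⟩)
    have h2 : ∑ n, a k n ^ 2 = ∑ n ∈ D k, sampleResidual x (b k) j (S k) n ^ 2 := by
      simp [a, ite_pow]
    rw [h2]
    exact not_lt.1 h1

/-- Resampling `w` on the shared part `b \ D` makes its contribution a centred Gaussian given the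
residuals, so it exceeds the standard deviation of the private part `D` only with the Gaussian
tail probability, unless the residuals on `b \ D` carry more than a fraction `1 / κ` of those on
`D`. -/
theorem measureReal_sqrt_lt_shared_le (hA : A.PosSemidef) {w : Fin p → ℝ}
    {S : Finset (Fin p)} (hw : w ⬝ᵥ A.mulVec w = 1)
    (hwS : ∀ a ∈ insert j S, A.mulVec w a = 0) {b D : Finset (Fin N)} (hDb : D ⊆ b) (κ : ℝ) :
    (Measure.pi fun _ : Fin N => multivariateGaussian 0 A).real
        {x | √(∑ n ∈ D, sampleResidual x b j S n ^ 2) <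
          ∑ n ∈ b \ D, sampleResidual x b j S n * (w ⬝ᵥ (x n).ofLp)} ≤
      Real.exp (-κ / 2) + (Measure.pi fun _ : Fin N => multivariateGaussian 0 A).real
        {x | ∑ n ∈ D, sampleResidual x b j S n ^ 2 < κ * ∑ n ∈ b \ D, sampleResidual x b j S n ^ 2} := by
  classical
  have hmr := fun n => measurable_sampleResidual (p := p) b j S n
  have hmw := fun (n : Fin N) => measurable_dotProduct_sample w n
  have hEm : MeasurableSet {x : Fin N → EuclideanSpace ℝ (Fin p) |
      √(∑ n ∈ D, sampleResidual x b j S n ^ 2) <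
          ∑ n ∈ b \ D, sampleResidual x b j S n * (w ⬝ᵥ (x n).ofLp)} := measurableSet_lt
    (Finset.measurable_sum _ fun n _ => (hmr n).pow_const 2).sqrt
    (Finset.measurable_sum _ fun n _ => (hmr n).mul (hmw n))
  have hBm : MeasurableSet {x : Fin N → EuclideanSpace ℝ (Fin p) |
      ∑ n ∈ D, sampleResidual x b j S n ^ 2 < κ * ∑ n ∈ b \ D, sampleResidual x b j S n ^ 2} :=
    measurableSet_lt (Finset.measurable_sum _ fun n _ => (hmr n).pow_const 2)
      ((Finset.measurable_sum _ fun n _ => (hmr n).pow_const 2).const_mul _)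
  set W : Fin N → Fin p → ℝ := fun n => if n ∈ b \ D then w else 0 with hWdef
  have hWb : ∀ n ∈ b, W n = w ∨ W n = 0 := fun n _ => by
    simp only [hWdef]; split_ifs <;> simp
  have hmp := measurePreserving_resample_pi hA (w := W) (fun n => by
    simp only [hWdef]; split_ifs <;> simp [hw])
  rw [← hmp.measureReal_preimage hEm.nullMeasurableSet]
  refine measureReal_prod_le_add (hmp.measurable hEm) hBm (Real.exp_pos _).le fun x hx => ?_
  set a : Fin N → ℝ := fun n => if n ∈ b \ D then sampleResidual x b j S n else 0
  have h1 := (hasLaw_sum_pi_gaussianReal a).measureReal_eq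
    (p := fun y => √(∑ n ∈ D, sampleResidual x b j S n ^ 2) < y) (by measurability)
  have h2 : ∑ n, a n ^ 2 = ∑ n ∈ b \ D, sampleResidual x b j S n ^ 2 := by
    simp only [a, ite_pow, ne_eq, OfNat.ofNat_ne_zero, not_false_eq_true, zero_pow,
      Finset.sum_ite_mem, Finset.univ_inter]
  have h3 := gaussianReal_Ioi_le (κ := κ) (v := (∑ n, a n ^ 2).toNNReal)
    (Real.sqrt_nonneg (∑ n ∈ D, sampleResidual x b j S n ^ 2)) (by
      rw [Real.sq_sqrt (by positivity), Real.coe_toNNReal _ (by positivity), h2]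
      exact not_lt.1 hx)
  have h4 : ∀ z, ∑ n ∈ D, sampleResidual (resample A W (x, z)) b j S n ^ 2 =
      ∑ n ∈ D, sampleResidual x b j S n ^ 2 := fun z => Finset.sum_congr rfl fun n hn => by
    rw [sampleResidual_resample hwS hWb (hDb hn)]
  have h5 : ∀ z, ∑ n ∈ b \ D, sampleResidual (resample A W (x, z)) b j S n *
      (w ⬝ᵥ (resample A W (x, z) n).ofLp) = ∑ n, a n * z n := fun z => by
    simp only [a, ite_mul, zero_mul, Finset.sum_ite_mem, Finset.univ_inter]
    refine Finset.sum_congr rfl fun n hn => ?_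
    rw [sampleResidual_resample hwS hWb (Finset.sdiff_subset hn),
      dotProduct_resample_of_eq hw (by simp only [hWdef, hn, if_true])]
  simp only [Set.mem_preimage, Set.mem_ofPred_eq, h4, h5]
  exact h1.trans_le h3

end

/-! ### Concentration of sample Gram matrices -/

theorem inv_sqrt_one_sub_le {u : ℝ} (hu : |u| ≤ 1 / 2) : (√(1 - u))⁻¹ ≤ Real.exp ((u + u ^ 2) / 2) := by
  obtain ⟨h1, h2⟩ := abs_le.1 hu
  have hpos : 0 < 1 - u := by linarith
  have key : 1 ≤ Real.exp (u + u ^ 2) * (1 - u) := by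
    rcases le_total 0 u with h | h
    · have := Real.quadratic_le_exp_of_nonneg (x := u + u ^ 2) (by positivity)
      have h3 : (1 + (u + u ^ 2) + (u + u ^ 2) ^ 2 / 2) * (1 - u) ≤ Real.exp (u + u ^ 2) * (1 - u) :=
        mul_le_mul_of_nonneg_right this hpos.le
      have h4 : 0 ≤ u ^ 2 * ((1 / 2 - u) * (1 + u)) := by
        have : 0 ≤ 1 / 2 - u := by linarith
        positivity
      nlinarith [mul_nonneg (sq_nonneg u) (mul_nonneg h hpos.le), sq_nonneg (u ^ 2),
        pow_nonneg h 4, pow_nonneg h 3]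
    · have := Real.add_one_le_exp (u + u ^ 2)
      have h3 := mul_le_mul_of_nonneg_right this hpos.le
      have h4 : u ^ 3 ≤ 0 := by
        have := mul_nonneg (neg_nonneg.2 h) (sq_nonneg u)
        nlinarith
      nlinarith
  have h5 : Real.exp ((u + u ^ 2) / 2) = √(Real.exp (u + u ^ 2)) := by
    rw [Real.exp_half]
  rw [h5, inv_le_iff_one_le_mul₀ (Real.sqrt_pos.2 hpos), ← Real.sqrt_mul (Real.exp_pos _).le]
  exact Real.one_le_sqrt.2 key

theorem integral_exp_mul_sq_gaussianReal {s : ℝ} (hs : s < 1 / 2) :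
    ∫ z, Real.exp (s * z ^ 2) ∂(gaussianReal 0 1) = (√(1 - 2 * s))⁻¹ := by
  rw [integral_gaussianReal_eq_integral_smul one_ne_zero]
  have h1 : ∀ z : ℝ, gaussianPDFReal 0 1 z • Real.exp (s * z ^ 2) =
      (√(2 * Real.pi))⁻¹ * Real.exp (-(1 / 2 - s) * z ^ 2) := by
    intro z
    simp only [gaussianPDFReal, smul_eq_mul, mul_assoc, ← Real.exp_add]
    congr 2
    · simp
    · simp
      ring
  simp_rw [h1]
  rw [integral_const_mul, integral_gaussian, ← Real.sqrt_inv, ← Real.sqrt_mul (by positivity),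
    ← Real.sqrt_inv]
  congr 1
  have : (1 - 2 * s) ≠ 0 := by linarith
  have : (1 / 2 - s) ≠ 0 := by linarith
  field_simp

/-- The centred square of a Gaussian is sub-exponential, with a bound symmetric in the sign of
`t`. -/
theorem integral_exp_mul_sq_sub_le {Ω : Type*} [MeasurableSpace Ω] {P : Measure Ω}
    {Y : Ω → ℝ} {v : NNReal} (hY : HasLaw Y (gaussianReal 0 v) P) {t : ℝ} (ht : |t * v| ≤ 1 / 4) :
    Integrable (fun ω => Real.exp (t * (Y ω ^ 2 - v))) P ∧
      ∫ ω, Real.exp (t * (Y ω ^ 2 - v)) ∂P ≤ Real.exp (2 * (t * v) ^ 2) := by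
  have hmap := gaussianReal_map_const_mul (μ := 0) (v := 1) (√v)
  have hs : (⟨√(v:ℝ) ^ 2, sq_nonneg _⟩ : NNReal) * 1 = v := by
    ext; simp
  rw [mul_zero] at hmap
  erw [hs] at hmap
  have hlt : t * v < 1 / 2 := by linarith [le_abs_self (t * v)]
  have h1 : ∫ ω, Real.exp (t * (Y ω ^ 2 - v)) ∂P =
      Real.exp (-(t * v)) * (√(1 - 2 * (t * v)))⁻¹ := by
    have h2 := hY.integral_comp (f := fun y => Real.exp (t * (y ^ 2 - v))) (by fun_prop)
    simp only [Function.comp_def] at h2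
    rw [h2, ← hmap, integral_map (by fun_prop) (by fun_prop),
      ← integral_exp_mul_sq_gaussianReal hlt, ← integral_const_mul]
    refine integral_congr_ae (ae_of_all _ fun z => ?_)
    simp only [← Real.exp_add, mul_pow, Real.sq_sqrt v.coe_nonneg]
    congr 1; ring
  have hpos : 0 < √(1 - 2 * (t * v)) := Real.sqrt_pos.2 (by linarith)
  constructor
  -- The integral is nonzero, so it is not the junk value of a non-integrable function.
  · by_contra hni
    rw [integral_undef hni] at h1
    have : 0 < Real.exp (-(t * v)) * (√(1 - 2 * (t * v)))⁻¹ := by positivity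
    linarith
  · rw [h1]
    have h3 := inv_sqrt_one_sub_le (u := 2 * (t * v)) (by rw [abs_mul, abs_two]; linarith)
    calc _ ≤ Real.exp (-(t * v)) * Real.exp ((2 * (t * v) + (2 * (t * v)) ^ 2) / 2) := by gcongr
      _ = Real.exp (2 * (t * v) ^ 2) := by rw [← Real.exp_add]; congr 1; ring

/-- Chernoff bound for sums of squares of independent centred Gaussians. Any upper bound `V` of
the variance will do, and the variance itself may vanish. -/
theorem measureReal_le_abs_sum_sq_sub_le {Ω ι : Type*} [MeasurableSpace Ω] {P : Measure Ω}
    [IsProbabilityMeasure P] {Y : ι → Ω → ℝ} (hm : ∀ n, Measurable (Y n)) {v : NNReal}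
    (hY : ∀ n, HasLaw (Y n) (gaussianReal 0 v) P) (hind : iIndepFun Y P) (s : Finset ι)
    {δ V : ℝ} (hδ : 0 < δ) (hδV : δ ≤ V) (hv : v ≤ V) :
    P.real {ω | δ * s.card ≤ |∑ n ∈ s, Y n ω ^ 2 - s.card * v|} ≤
      2 * Real.exp (-(δ ^ 2 / (8 * V ^ 2)) * s.card) := by
  have hV : 0 < V := hδ.trans_le hδV
  set X : ι → Ω → ℝ := fun n ω => Y n ω ^ 2 - v with hX
  have hXm : ∀ n, Measurable (X n) := fun n => ((hm n).pow_const 2).sub_const _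
  have hXi : iIndepFun X P := hind.comp (fun _ y => y ^ 2 - (v : ℝ)) fun _ => by fun_prop
  have hsum : ∀ ω, (∑ n ∈ s, X n) ω = ∑ n ∈ s, Y n ω ^ 2 - s.card * v := by
    intro ω
    simp [hX]
  have hmgf : ∀ t : ℝ, |t| * V ≤ 1 / 4 →
      Integrable (fun ω => Real.exp (t * (∑ n ∈ s, X n) ω)) P ∧
      mgf (∑ n ∈ s, X n) P t ≤ Real.exp (2 * (t * V) ^ 2 * s.card) := by
    intro t ht
    have ht' : |t * v| ≤ 1 / 4 := by
      rw [abs_mul, abs_of_nonneg v.coe_nonneg]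
      exact (mul_le_mul_of_nonneg_left hv (abs_nonneg t)).trans ht
    refine ⟨hXi.integrable_exp_mul_sum hXm fun n _ => (integral_exp_mul_sq_sub_le (hY n) ht').1, ?_⟩
    rw [hXi.mgf_sum hXm]
    calc ∏ n ∈ s, mgf (X n) P t ≤ ∏ _n ∈ s, Real.exp (2 * (t * V) ^ 2) := by
          refine Finset.prod_le_prod (fun n _ => mgf_nonneg) fun n _ => ?_
          refine (integral_exp_mul_sq_sub_le (hY n) ht').2.trans ?_
          rw [Real.exp_le_exp, mul_pow, mul_pow]
          have := v.coe_nonneg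
          gcongr
      _ = Real.exp (2 * (t * V) ^ 2 * s.card) := by
          rw [Finset.prod_const, ← Real.exp_nat_mul]; congr 1; ring
  -- The minimizer of `- t δ + 2 t² V²`.
  set t := δ / (4 * V ^ 2) with ht
  have htpos : 0 < t := by positivity
  have htV : |t| * V ≤ 1 / 4 := by
    rw [abs_of_pos htpos, ht]
    rw [show δ / (4 * V ^ 2) * V = (δ / V) / 4 by field_simp]
    have := (div_le_one hV).2 hδV
    linarith
  have hexp : Real.exp (-t * (δ * s.card)) * Real.exp (2 * (t * V) ^ 2 * s.card) =
      Real.exp (-(δ ^ 2 / (8 * V ^ 2)) * s.card) := by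
    rw [← Real.exp_add, ht]
    congr 1
    field_simp
    ring
  obtain ⟨hi1, hm1⟩ := hmgf t htV
  obtain ⟨hi2, hm2⟩ := hmgf (-t) (by rwa [abs_neg])
  have hup := measure_ge_le_exp_mul_mgf (μ := P) (δ * s.card) htpos.le hi1
  have hlo := measure_le_le_exp_mul_mgf (μ := P) (-(δ * s.card)) (neg_nonpos.2 htpos.le) hi2
  have hup' := hup.trans (mul_le_mul_of_nonneg_left hm1 (Real.exp_pos _).le)
  have hlo' := hlo.trans (mul_le_mul_of_nonneg_left hm2 (Real.exp_pos _).le)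
  rw [hexp] at hup'
  rw [show - -t * -(δ * s.card) = -t * (δ * s.card) by ring,
    show 2 * (-t * V) ^ 2 * (s.card : ℝ) = 2 * (t * V) ^ 2 * s.card by ring, hexp] at hlo'
  calc _ ≤ P.real ({ω | δ * s.card ≤ (∑ n ∈ s, X n) ω} ∪ {ω | (∑ n ∈ s, X n) ω ≤ -(δ * s.card)}) := by
        refine measureReal_mono fun ω hω => ?_
        simp only [Set.mem_ofPred_eq, Set.mem_union, hsum] at hω ⊢
        rcases le_abs.1 hω with h | h
        · exact Or.inl h
        · exact Or.inr (by linarith)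
    _ ≤ _ := measureReal_union_le _ _
    _ ≤ _ := by linarith

section
variable {p : ℕ} {A : Matrix (Fin p) (Fin p) ℝ}

theorem BoundedPrincipalEigenvalues.quadratic_bounds {m : ℕ} {lo hi : ℝ}
    (h : BoundedPrincipalEigenvalues A m lo hi) (hA : A.IsHermitian) {R : Finset (Fin p)}
    (hR : R.card ≤ m) {c : Fin p → ℝ} (hc : ∀ a ∉ R, c a = 0) :
    lo * ∑ a, c a ^ 2 ≤ c ⬝ᵥ A.mulVec c ∧ c ⬝ᵥ A.mulVec c ≤ hi * ∑ a, c a ^ 2 := by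
  set B := principalSubmatrix A R with hB
  have hBh : B.IsHermitian := hA.submatrix _
  have hspec : ∀ μ ∈ spectrum ℝ B, lo ≤ μ ∧ μ ≤ hi := by
    intro μ hμ
    refine h R hR μ ?_
    rwa [Module.End.hasEigenvalue_iff_mem_spectrum, Matrix.spectrum_toLin']
  have hone : ∀ r : ℝ, (algebraMap ℝ (Matrix R R ℝ) r).IsHermitian := fun r => by
    ext a b
    simp [Matrix.algebraMap_matrix_apply, Matrix.conjTranspose_apply, eq_comm]
  have h1 : (B - algebraMap ℝ _ lo).PosSemidef := by
    refine (hBh.sub (hone lo)).posSemidef_iff_eigenvalues_nonneg.2 fun k => ?_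
    have := (hBh.sub (hone lo)).eigenvalues_mem_spectrum_real k
    rw [← spectrum.sub_singleton_eq] at this
    obtain ⟨μ, hμ, l, hl, he⟩ := this
    rw [← he, Set.mem_singleton_iff.1 hl]
    simpa using (hspec μ hμ).1
  have h2 : (algebraMap ℝ _ hi - B).PosSemidef := by
    refine ((hone hi).sub hBh).posSemidef_iff_eigenvalues_nonneg.2 fun k => ?_
    have := ((hone hi).sub hBh).eigenvalues_mem_spectrum_real k
    rw [← spectrum.singleton_sub_eq] at this
    obtain ⟨l, hl, μ, hμ, he⟩ := this
    rw [← he, Set.mem_singleton_iff.1 hl]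
    simpa using (hspec μ hμ).2
  have hsq : ∑ a : R, c a ^ 2 = ∑ a, c a ^ 2 := by
    rw [Finset.sum_coe_sort R (fun a => c a ^ 2)]
    exact Finset.sum_subset (Finset.subset_univ _) fun a _ ha => by simp [hc a ha]
  have hq : (fun a : R => c a) ⬝ᵥ B.mulVec (fun a : R => c a) = c ⬝ᵥ A.mulVec c := by
    have : B.mulVec (fun a : R => c a) = fun a : R => A.mulVec c a :=
      funext fun a => principalSubmatrix_mulVec hc a
    rw [this]
    simp only [dotProduct]
    rw [Finset.sum_coe_sort R (fun a => c a * A.mulVec c a)]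
    exact Finset.sum_subset (Finset.subset_univ _) fun a _ ha => by simp [hc a ha]
  have hal : ∀ r : ℝ, (fun a : R => c a) ⬝ᵥ (algebraMap ℝ (Matrix R R ℝ) r).mulVec (fun a : R => c a)
      = r * ∑ a, c a ^ 2 := by
    intro r
    rw [Algebra.algebraMap_eq_smul_one, Matrix.smul_mulVec, Matrix.one_mulVec, dotProduct_smul,
      ← hsq]
    simp [dotProduct, sq]
  have e1 := h1.dotProduct_mulVec_nonneg (fun a : R => c a)
  have e2 := h2.dotProduct_mulVec_nonneg (fun a : R => c a)
  simp only [star_trivial, Matrix.sub_mulVec, dotProduct_sub, hal, hq] at e1 e2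
  exact ⟨by linarith, by linarith⟩

/-- Entrywise control of a Gram matrix on `R` controls its quadratic form on vectors supported in
`R`. -/
theorem abs_sum_sq_sub_le {N : ℕ} {x : Fin N → EuclideanSpace ℝ (Fin p)} {D : Finset (Fin N)}
    {R : Finset (Fin p)} {c : Fin p → ℝ} (hc : ∀ a ∉ R, c a = 0) {η : ℝ}
    (h : ∀ a ∈ R, ∀ b ∈ R, |∑ n ∈ D, x n a * x n b - D.card * A a b| ≤ η) :
    |∑ n ∈ D, (c ⬝ᵥ (x n).ofLp) ^ 2 - D.card * (c ⬝ᵥ A.mulVec c)| ≤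
      η * (R.card * ∑ a, c a ^ 2) := by
  have hsub : ∀ f : Fin p → ℝ, (∀ a ∉ R, f a = 0) → ∑ a, f a = ∑ a ∈ R, f a := fun f hf =>
    (Finset.sum_subset (Finset.subset_univ R) fun a _ ha => hf a ha).symm
  have h1 : ∑ n ∈ D, (c ⬝ᵥ (x n).ofLp) ^ 2 - D.card * (c ⬝ᵥ A.mulVec c) =
      ∑ a ∈ R, ∑ b ∈ R, c a * c b * (∑ n ∈ D, x n a * x n b - D.card * A a b) := by
    have e1 : ∑ n ∈ D, (c ⬝ᵥ (x n).ofLp) ^ 2 =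
        ∑ a ∈ R, ∑ b ∈ R, c a * c b * ∑ n ∈ D, x n a * x n b := by
      calc _ = ∑ n ∈ D, ∑ a ∈ R, ∑ b ∈ R, (c a * x n a) * (c b * x n b) := by
            refine Finset.sum_congr rfl fun n _ => ?_
            rw [sq, ← Finset.sum_mul_sum]
            simp only [dotProduct]
            rw [hsub _ fun a ha => by rw [hc a ha, zero_mul]]
        _ = _ := by
            rw [Finset.sum_comm]
            refine Finset.sum_congr rfl fun a _ => ?_
            rw [Finset.sum_comm]
            refine Finset.sum_congr rfl fun b _ => ?_
            rw [Finset.mul_sum]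
            exact Finset.sum_congr rfl fun n _ => by ring
    have e2 : c ⬝ᵥ A.mulVec c = ∑ a ∈ R, ∑ b ∈ R, c a * c b * A a b := by
      simp only [dotProduct, Matrix.mulVec]
      rw [hsub _ fun a ha => by rw [hc a ha, zero_mul]]
      refine Finset.sum_congr rfl fun a _ => ?_
      rw [hsub _ fun b hb => by rw [hc b hb, mul_zero], Finset.mul_sum]
      exact Finset.sum_congr rfl fun b _ => by ring
    rw [e1, e2, Finset.mul_sum, ← Finset.sum_sub_distrib]
    refine Finset.sum_congr rfl fun a _ => ?_
    rw [Finset.mul_sum, ← Finset.sum_sub_distrib]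
    exact Finset.sum_congr rfl fun b _ => by ring
  rcases R.eq_empty_or_nonempty with rfl | ⟨a₀, ha₀⟩
  · rw [h1]; simp
  have hη : 0 ≤ η := (abs_nonneg _).trans (h a₀ ha₀ a₀ ha₀)
  calc _ ≤ ∑ a ∈ R, ∑ b ∈ R, |c a| * |c b| * η := by
        rw [h1]
        refine (Finset.abs_sum_le_sum_abs _ _).trans (Finset.sum_le_sum fun a ha => ?_)
        refine (Finset.abs_sum_le_sum_abs _ _).trans (Finset.sum_le_sum fun b hb => ?_)
        rw [abs_mul, abs_mul]
        exact mul_le_mul_of_nonneg_left (h a ha b hb) (by positivity)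
    _ = η * (∑ a ∈ R, |c a|) ^ 2 := by
        rw [sq, Finset.sum_mul_sum, Finset.mul_sum]
        refine Finset.sum_congr rfl fun a _ => ?_
        rw [Finset.mul_sum]
        exact Finset.sum_congr rfl fun b _ => by ring
    _ ≤ η * (R.card * ∑ a ∈ R, |c a| ^ 2) := by
        gcongr
        exact sq_sum_le_card_mul_sum_sq
    _ = η * (R.card * ∑ a, c a ^ 2) := by
        simp only [sq_abs]
        rw [hsub _ fun a ha => by simp [hc a ha]]

variable {N : ℕ}

theorem hasLaw_dotProduct_pi (hA : A.PosSemidef) (f : Fin p → ℝ) (n : Fin N) :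
    HasLaw (fun x : Fin N → EuclideanSpace ℝ (Fin p) => f ⬝ᵥ (x n).ofLp)
      (gaussianReal 0 (f ⬝ᵥ A.mulVec f).toNNReal)
      (Measure.pi fun _ : Fin N => multivariateGaussian 0 A) :=
  (hasLaw_dotProduct_multivariateGaussian hA f).comp
    (measurePreserving_eval (fun _ : Fin N => multivariateGaussian 0 A) n).hasLaw

theorem measureReal_le_abs_sum_dotProduct_sq_sub_le (hA : A.PosSemidef) (f : Fin p → ℝ)
    (D : Finset (Fin N)) {δ V : ℝ} (hδ : 0 < δ) (hδV : δ ≤ V) (hv : f ⬝ᵥ A.mulVec f ≤ V) :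
    (Measure.pi fun _ : Fin N => multivariateGaussian 0 A).real
      {x | δ * D.card ≤ |∑ n ∈ D, (f ⬝ᵥ (x n).ofLp) ^ 2 - D.card * (f ⬝ᵥ A.mulVec f)|} ≤
      2 * Real.exp (-(δ ^ 2 / (8 * V ^ 2)) * D.card) := by
  have hnn : 0 ≤ f ⬝ᵥ A.mulVec f := by simpa using hA.dotProduct_mulVec_nonneg f
  have hm : Measurable fun x : EuclideanSpace ℝ (Fin p) => f ⬝ᵥ x.ofLp := by
    unfold dotProduct; fun_prop
  have := measureReal_le_abs_sum_sq_sub_le (fun n => measurable_dotProduct_sample f n)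
    (fun n => hasLaw_dotProduct_pi (N := N) hA f n)
    (iIndepFun_pi (μ := fun _ : Fin N => multivariateGaussian 0 A)
      (X := fun _ x => f ⬝ᵥ x.ofLp) fun _ => hm.aemeasurable) D hδ hδV
    (by rwa [Real.coe_toNNReal _ hnn])
  rwa [Real.coe_toNNReal _ hnn] at this

/-- The products `x n a * x n b` are reduced to squares by polarization with `e_a ± e_b`; these
functionals have variance at most `4 * hi`. -/
theorem measureReal_exists_gram_deviation_le (hA : A.PosSemidef) {lo hi : ℝ} {m : ℕ}
    (h : BoundedPrincipalEigenvalues A m lo hi) (hm : 2 ≤ m) (R : Finset (Fin p))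
    (D : Finset (Fin N)) {δ : ℝ} (hδ : 0 < δ) (hδV : δ ≤ 4 * hi) :
    (Measure.pi fun _ : Fin N => multivariateGaussian 0 A).real
      {x | ∃ a ∈ R, ∃ b ∈ R, δ / 2 * D.card ≤ |∑ n ∈ D, x n a * x n b - D.card * A a b|} ≤
      4 * R.card ^ 2 * Real.exp (-(δ ^ 2 / (8 * (4 * hi) ^ 2)) * D.card) := by
  set μ := Measure.pi fun _ : Fin N => multivariateGaussian 0 A
  have hhi : 0 < hi := by linarith
  have hpair : ∀ a ∈ R, ∀ b ∈ R,
      μ.real {x | δ / 2 * D.card ≤ |∑ n ∈ D, x n a * x n b - D.card * A a b|} ≤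
        4 * Real.exp (-(δ ^ 2 / (8 * (4 * hi) ^ 2)) * D.card) := by
    intro a _ b _
    set f : ℝ → Fin p → ℝ := fun s => Pi.single a 1 + s • Pi.single b 1 with hf
    have hsupp : ∀ s, ∀ c ∉ ({a, b} : Finset (Fin p)), f s c = 0 := by
      intro s c hc
      simp only [Finset.mem_insert, Finset.mem_singleton, not_or] at hc
      simp [hf, hc.1, hc.2]
    have hcard : ({a, b} : Finset (Fin p)).card ≤ m := Finset.card_le_two.trans hm
    have hnorm : ∀ s : ℝ, s ^ 2 = 1 → ∑ c, f s c ^ 2 ≤ 4 := by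
      intro s hs
      calc ∑ c, f s c ^ 2 ≤ ∑ c, (2 * (Pi.single a 1 : Fin p → ℝ) c +
            2 * (Pi.single b 1 : Fin p → ℝ) c) := by
            refine Finset.sum_le_sum fun c _ => ?_
            have e1 : ((Pi.single a 1 : Fin p → ℝ) c) ^ 2 = (Pi.single a 1 : Fin p → ℝ) c := by
              by_cases hca : c = a
              · subst hca; simp
              · simp [hca]
            have e2 : ((Pi.single b 1 : Fin p → ℝ) c) ^ 2 = (Pi.single b 1 : Fin p → ℝ) c := by
              by_cases hcb : c = b
              · subst hcb; simp
              · simp [hcb]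
            simp only [hf, Pi.add_apply, Pi.smul_apply, smul_eq_mul]
            nlinarith [sq_nonneg ((Pi.single a 1 : Fin p → ℝ) c - s * (Pi.single b 1 : Fin p → ℝ) c)]
        _ = 4 := by
            rw [Finset.sum_add_distrib, ← Finset.mul_sum, ← Finset.mul_sum]
            simp
            norm_num
    have hV : ∀ s : ℝ, s ^ 2 = 1 → f s ⬝ᵥ A.mulVec (f s) ≤ 4 * hi := fun s hs =>
      ((h.quadratic_bounds hA.isHermitian hcard (hsupp s)).2).trans (by
        nlinarith [hnorm s hs])
    have hsym : A b a = A a b := by simpa using hA.isHermitian.apply a b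
    have hfA : ∀ s, f s ⬝ᵥ A.mulVec (f s) = A a a + 2 * s * A a b + s ^ 2 * A b b := by
      intro s
      simp only [hf, Matrix.mulVec_add, Matrix.mulVec_smul, add_dotProduct, dotProduct_add,
        smul_dotProduct, dotProduct_smul, Matrix.mulVec_single_one, single_one_dotProduct,
        Matrix.col_apply, smul_eq_mul]
      rw [hsym]; ring
    have hfx : ∀ s (x : Fin N → EuclideanSpace ℝ (Fin p)), ∑ n ∈ D, (f s ⬝ᵥ (x n).ofLp) ^ 2 =
        ∑ n ∈ D, x n a ^ 2 + 2 * s * ∑ n ∈ D, x n a * x n b + s ^ 2 * ∑ n ∈ D, x n b ^ 2 := by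
      intro s x
      simp only [hf, add_dotProduct, smul_dotProduct, single_one_dotProduct, smul_eq_mul,
        Finset.mul_sum, ← Finset.sum_add_distrib]
      exact Finset.sum_congr rfl fun n _ => by ring
    have hP := measureReal_le_abs_sum_dotProduct_sq_sub_le hA (f 1) D hδ hδV (hV 1 (by norm_num))
    have hM := measureReal_le_abs_sum_dotProduct_sq_sub_le hA (f (-1)) D hδ hδV
      (hV (-1) (by norm_num))
    refine (measureReal_mono (s₂ := {x | δ * D.card ≤ |∑ n ∈ D, (f 1 ⬝ᵥ (x n).ofLp) ^ 2 -
      D.card * (f 1 ⬝ᵥ A.mulVec (f 1))|} ∪ {x | δ * D.card ≤ |∑ n ∈ D, (f (-1) ⬝ᵥ (x n).ofLp) ^ 2 -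
      D.card * (f (-1) ⬝ᵥ A.mulVec (f (-1)))|}) ?_).trans
      ((measureReal_union_le _ _).trans (by linarith))
    intro x hx
    by_contra hn
    simp only [Set.mem_union, Set.mem_ofPred_eq, not_or, not_le, hfx, hfA] at hn hx
    obtain ⟨h1, h2⟩ := hn
    rw [abs_lt] at h1 h2
    rcases le_abs.1 hx with h3 | h3 <;> linarith [h1.1, h1.2, h2.1, h2.2]
  calc _ ≤ μ.real (⋃ ab ∈ R ×ˢ R, {x | δ / 2 * D.card ≤
          |∑ n ∈ D, x n ab.1 * x n ab.2 - D.card * A ab.1 ab.2|}) := by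
        refine measureReal_mono ?_ (measure_ne_top _ _)
        rintro x ⟨a, ha, b, hb, hab⟩
        simp only [Set.mem_iUnion]
        exact ⟨(a, b), Finset.mk_mem_product ha hb, hab⟩
    _ ≤ ∑ ab ∈ R ×ˢ R, 4 * Real.exp (-(δ ^ 2 / (8 * (4 * hi) ^ 2)) * D.card) := by
        refine (measureReal_biUnion_finset_le _ _).trans (Finset.sum_le_sum fun ab hab => ?_)
        rw [Finset.mem_product] at hab
        exact hpair ab.1 hab.1 ab.2 hab.2
    _ = _ := by
        rw [Finset.sum_const, Finset.card_product, nsmul_eq_mul]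
        push_cast; ring

/-- The residuals are `c ⬝ x n` for a random vector `c` supported on `S ∪ {j}`. On the event that
the Gram matrices of both `D` and `T` are entrywise close to their means, `∑ n ∈ E, (c ⬝ x n) ^ 2`
lies between `lo / 2 * #E * ‖c‖²` and `2 * hi * #E * ‖c‖²` for every such `c`. -/
theorem measureReal_sampleResidual_lt_le (hA : A.PosSemidef) {lo hi : ℝ} {r : ℕ} (hlo : 0 < lo)
    (h : BoundedPrincipalEigenvalues A (r + 1) lo hi) {j : Fin p} {S : Finset (Fin p)}
    (hS : (insert j S).card ≤ r) (b : Finset (Fin N)) {D T : Finset (Fin N)}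
    (hTD : T.card ≤ D.card) {κ : ℝ} (hκ : 0 ≤ κ) (hκT : κ * (4 * hi * T.card) ≤ lo * D.card) :
    (Measure.pi fun _ : Fin N => multivariateGaussian 0 A).real
        {x | ∑ n ∈ D, sampleResidual x b j S n ^ 2 < κ * ∑ n ∈ T, sampleResidual x b j S n ^ 2} ≤
      8 * r ^ 2 * Real.exp (-(lo ^ 2 / (128 * r ^ 2 * hi ^ 2)) * T.card) := by
  set μ := Measure.pi fun _ : Fin N => multivariateGaussian 0 A
  set R := insert j S with hR
  have hRr : (R.card : ℝ) ≤ r := by exact_mod_cast hS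
  have hr1 : 1 ≤ r := (Finset.card_pos.2 ⟨j, Finset.mem_insert_self _ _⟩).trans_le hS
  have hr1' : (1 : ℝ) ≤ r := by exact_mod_cast hr1
  have hlohi : lo ≤ hi := by
    have := h.quadratic_bounds hA.isHermitian (R := {j}) (c := Pi.single j 1) (by simp)
      (by intro a ha; simp at ha; simp [ha])
    have hs : ∑ a, (Pi.single j 1 : Fin p → ℝ) a ^ 2 = 1 := by
      rw [Finset.sum_eq_single j (fun a _ ha => by simp [ha]) (by simp)]
      simp
    rw [hs] at this
    linarith
  have hhi : 0 < hi := by linarith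
  -- An entrywise error `δ / 2` changes the quadratic form on `r` coordinates by at most `lo / 2`.
  set δ := lo / r with hδ
  have hδpos : 0 < δ := by positivity
  have hδlo : δ ≤ lo := div_le_self hlo.le hr1'
  have hδV : δ ≤ 4 * hi := by linarith
  have hexp : ∀ E : Finset (Fin N), T.card ≤ E.card →
      Real.exp (-(δ ^ 2 / (8 * (4 * hi) ^ 2)) * E.card) ≤
        Real.exp (-(lo ^ 2 / (128 * r ^ 2 * hi ^ 2)) * T.card) := by
    intro E hE
    rw [Real.exp_le_exp, neg_mul, neg_mul, neg_le_neg_iff]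
    have : δ ^ 2 / (8 * (4 * hi) ^ 2) = lo ^ 2 / (128 * r ^ 2 * hi ^ 2) := by
      rw [hδ]; field_simp; norm_num
    rw [this]
    gcongr
  have hdev : ∀ E : Finset (Fin N), T.card ≤ E.card →
      μ.real {x | ∃ a ∈ R, ∃ c ∈ R, δ / 2 * E.card ≤ |∑ n ∈ E, x n a * x n c - E.card * A a c|} ≤
        4 * r ^ 2 * Real.exp (-(lo ^ 2 / (128 * r ^ 2 * hi ^ 2)) * T.card) := fun E hE =>
    (measureReal_exists_gram_deviation_le hA h (by omega) R E hδpos hδV).trans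
      (mul_le_mul (by gcongr) (hexp E hE) (Real.exp_pos _).le (by positivity))
  have hquad : ∀ (E : Finset (Fin N)) (x : Fin N → EuclideanSpace ℝ (Fin p)),
      (¬ ∃ a ∈ R, ∃ c ∈ R, δ / 2 * E.card ≤ |∑ n ∈ E, x n a * x n c - E.card * A a c|) →
      lo / 2 * E.card * ∑ a, residualCoeff x b j S a ^ 2 ≤ ∑ n ∈ E, sampleResidual x b j S n ^ 2 ∧
      ∑ n ∈ E, sampleResidual x b j S n ^ 2 ≤
        2 * hi * E.card * ∑ a, residualCoeff x b j S a ^ 2 := by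
    intro E x hx
    push Not at hx
    have hsupp : ∀ a ∉ R, residualCoeff x b j S a = 0 := fun a ha => residualCoeff_of_notMem ha
    have h1 := abs_sum_sq_sub_le (A := A) (D := E) hsupp (fun a ha c hc => (hx a ha c hc).le)
    obtain ⟨h2, h3⟩ := h.quadratic_bounds hA.isHermitian (hS.trans (Nat.le_succ r)) hsupp
    set q := ∑ a, residualCoeff x b j S a ^ 2
    have hq : 0 ≤ q := by positivity
    have h4 : δ / 2 * E.card * (R.card * q) ≤ lo / 2 * E.card * q := by
      calc _ ≤ δ / 2 * E.card * (r * q) := by gcongr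
        _ = _ := by rw [hδ]; field_simp
    have h5 := abs_le.1 (h1.trans h4)
    have hE : (0 : ℝ) ≤ E.card := by positivity
    have h6 := mul_le_mul_of_nonneg_left h2 hE
    have h7 := mul_le_mul_of_nonneg_left h3 hE
    have h8 : lo * (E.card * q) ≤ hi * (E.card * q) := by gcongr
    have h9 : 0 ≤ hi * (E.card * q) := by positivity
    change _ ≤ ∑ n ∈ E, (residualCoeff x b j S ⬝ᵥ (x n).ofLp) ^ 2 ∧
      ∑ n ∈ E, (residualCoeff x b j S ⬝ᵥ (x n).ofLp) ^ 2 ≤ _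
    constructor <;> nlinarith [h5.1, h5.2]
  refine (measureReal_mono (s₂ :=
    {x | ∃ a ∈ R, ∃ c ∈ R, δ / 2 * D.card ≤ |∑ n ∈ D, x n a * x n c - D.card * A a c|} ∪
    {x | ∃ a ∈ R, ∃ c ∈ R, δ / 2 * T.card ≤ |∑ n ∈ T, x n a * x n c - T.card * A a c|}) ?_).trans
    ((measureReal_union_le _ _).trans (by linarith [hdev D hTD, hdev T le_rfl]))
  intro x hx
  by_contra hn
  rw [Set.mem_union, not_or] at hn
  have h1 := (hquad D x hn.1).1
  have h2 := (hquad T x hn.2).2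
  simp only [Set.mem_ofPred_eq] at hx
  set q := ∑ a, residualCoeff x b j S a ^ 2
  have hq : 0 ≤ q := by positivity
  have h3 := mul_le_mul_of_nonneg_left h2 hκ
  have h4 := mul_le_mul_of_nonneg_right hκT hq
  nlinarith

end

/-! ### Overlaps of random batches -/

theorem card_filter_le_card_inter_le {N M t : ℕ} (b₀ : Finset (Fin N)) :
    ((Finset.powersetCard M (Finset.univ : Finset (Fin N))).filter
      (fun b => t ≤ (b ∩ b₀).card)).card ≤ b₀.card.choose t * (N - t).choose (M - t) := by
  classical
  have hsup : ∀ u ∈ Finset.powersetCard t b₀,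
      ((Finset.powersetCard M (Finset.univ : Finset (Fin N))).filter (fun b => u ⊆ b)).card ≤
        (N - t).choose (M - t) := by
    intro u hu
    have hut := (Finset.mem_powersetCard.1 hu).2
    have : (Finset.powersetCard (M - t) (Finset.univ \ u)).card = (N - t).choose (M - t) := by
      rw [Finset.card_powersetCard, Finset.card_sdiff_of_subset (Finset.subset_univ u),
        Finset.card_univ, Fintype.card_fin, hut]
    rw [← this]
    refine Finset.card_le_card_of_injOn (fun b => b \ u) (fun b hb => ?_) fun b hb b' hb' h => ?_
    · simp only [Finset.coe_filter, Set.mem_ofPred_eq, Finset.mem_powersetCard] at hb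
      simp only [Finset.mem_coe, Finset.mem_powersetCard]
      refine ⟨Finset.sdiff_subset_sdiff (Finset.subset_univ _) le_rfl, ?_⟩
      rw [Finset.card_sdiff_of_subset hb.2, hb.1.2, hut]
    · simp only [Finset.coe_filter, Set.mem_ofPred_eq] at hb hb'
      have h' : b \ u = b' \ u := h
      rw [← Finset.sdiff_union_of_subset hb.2, h', Finset.sdiff_union_of_subset hb'.2]
  calc _ ≤ ((Finset.powersetCard t b₀).biUnion fun u =>
          (Finset.powersetCard M (Finset.univ : Finset (Fin N))).filter (fun b => u ⊆ b)).card := by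
        refine Finset.card_le_card fun b hb => ?_
        rw [Finset.mem_filter] at hb
        obtain ⟨u, hu, hcard⟩ := Finset.exists_subset_card_eq hb.2
        rw [Finset.mem_biUnion]
        refine ⟨u, Finset.mem_powersetCard.2 ⟨hu.trans Finset.inter_subset_right, hcard⟩, ?_⟩
        exact Finset.mem_filter.2 ⟨hb.1, hu.trans Finset.inter_subset_left⟩
    _ ≤ (Finset.powersetCard t b₀).card * (N - t).choose (M - t) :=
        Finset.card_biUnion_le_card_mul _ _ _ hsup
    _ = _ := by rw [Finset.card_powersetCard]

/-- The union bound over `t`-subsets of the intersection: the left side over `N.choose M` equals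
`(M.choose t)² / N.choose t`, which is at most `(2 e M² / (t N))^t`. -/
theorem choose_mul_choose_le {N M t : ℕ} (htM : t ≤ M) (hMN : M ≤ N) (htN : 2 * t ≤ N)
    (ht : 12 * (M : ℝ) ^ 2 ≤ t * N) :
    (M.choose t : ℝ) * (N - t).choose (M - t) ≤ (1 / 2) ^ t * N.choose M := by
  have hid : (N.choose M : ℝ) * M.choose t = N.choose t * (N - t).choose (M - t) := by
    exact_mod_cast Nat.choose_mul htM
  have hNt : (0 : ℝ) < N.choose t := by exact_mod_cast Nat.choose_pos (by omega)
  have hf : (0 : ℝ) < t.factorial := by exact_mod_cast t.factorial_pos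
  have h1 : (M.choose t : ℝ) ≤ (M : ℝ) ^ t / t.factorial := Nat.choose_le_pow_div t M
  have h2 : ((N : ℝ) / 2) ^ t / t.factorial ≤ N.choose t := by
    refine le_trans ?_ (Nat.pow_le_choose t N)
    gcongr
    rw [div_le_iff₀ (by norm_num)]
    exact_mod_cast (by omega : N ≤ (N + 1 - t) * 2)
  have h3 : (t : ℝ) ^ t ≤ Real.exp 1 ^ t * t.factorial := by
    have := Real.pow_div_factorial_le_exp t (Nat.cast_nonneg t) t
    rw [div_le_iff₀ hf] at this
    rwa [← Real.exp_nat_mul, mul_one]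
  have h4 : (M.choose t : ℝ) * M.choose t ≤ (1 / 2) ^ t * N.choose t := by
    have e1 : (M.choose t : ℝ) * M.choose t ≤ ((M : ℝ) ^ 2) ^ t / (t.factorial * t.factorial) := by
      calc _ ≤ ((M : ℝ) ^ t / t.factorial) * ((M : ℝ) ^ t / t.factorial) := by gcongr
        _ = _ := by rw [div_mul_div_comm]; ring
    have e2 : ((M : ℝ) ^ 2) ^ t ≤ ((1 / 2) * ((N : ℝ) / 2)) ^ t * t.factorial := by
      have e3 : (M : ℝ) ^ 2 ≤ (1 / 2 * (N / 2)) * (t / Real.exp 1) := by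
        rw [mul_div_assoc', le_div_iff₀ (Real.exp_pos 1)]
        have := Real.exp_one_lt_three
        nlinarith [sq_nonneg (M : ℝ)]
      calc ((M : ℝ) ^ 2) ^ t ≤ ((1 / 2 * (N / 2)) * (t / Real.exp 1)) ^ t := by gcongr
        _ = (1 / 2 * ((N : ℝ) / 2)) ^ t * ((t : ℝ) ^ t / Real.exp 1 ^ t) := by
            rw [mul_pow, div_pow]
        _ ≤ _ := by
            gcongr
            rw [div_le_iff₀ (by positivity)]
            linarith
    calc _ ≤ ((M : ℝ) ^ 2) ^ t / (t.factorial * t.factorial) := e1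
      _ ≤ (((1 / 2) * ((N : ℝ) / 2)) ^ t * t.factorial) / (t.factorial * t.factorial) := by gcongr
      _ = (1 / 2) ^ t * (((N : ℝ) / 2) ^ t / t.factorial) := by rw [mul_pow]; field_simp
      _ ≤ _ := by gcongr
  have h5 : (M.choose t : ℝ) * (N - t).choose (M - t) * N.choose t =
      N.choose M * (M.choose t * M.choose t) := by linear_combination -(M.choose t : ℝ) * hid
  refine le_of_mul_le_mul_right ?_ hNt
  rw [h5]
  calc _ ≤ (N.choose M : ℝ) * ((1 / 2) ^ t * N.choose t) := by gcongr
    _ = _ := by ring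

/-- Two batches of size `M` share about `M² / N` samples; a constant factor more is exponentially
unlikely. -/
theorem uniformOn_le_card_inter_le {N M t : ℕ} (hMN : M ≤ N) (htN : 2 * t ≤ N)
    (ht : 12 * (M : ℝ) ^ 2 ≤ t * N) {b₀ : Finset (Fin N)} (hb₀ : b₀.card = M) :
    (uniformOn {b : Finset (Fin N) | b.card = M}).real {b | t ≤ (b₀ ∩ b).card} ≤ (1 / 2) ^ t := by
  classical
  by_cases htM : t ≤ M
  swap
  · have : {b | t ≤ (b₀ ∩ b).card} = ∅ := by
      ext b
      have := Finset.card_le_card (Finset.inter_subset_left (s₁ := b₀) (s₂ := b))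
      simp only [Set.mem_ofPred_eq, Set.mem_empty_iff_false, iff_false]
      omega
    rw [this]
    simp
  have hs : {b : Finset (Fin N) | b.card = M} =
      (Finset.powersetCard M (Finset.univ : Finset (Fin N)) : Set (Finset (Fin N))) := by
    ext b; simp
  have hu : {b : Finset (Fin N) | t ≤ (b₀ ∩ b).card} =
      ((Finset.univ.filter fun b : Finset (Fin N) => t ≤ (b ∩ b₀).card : Finset _) :
        Set (Finset (Fin N))) := by
    ext b; simp [Finset.inter_comm]
  rw [Measure.real, hs, hu, uniformOn_apply_finset, ENNReal.toReal_div, ENNReal.toReal_natCast,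
    ENNReal.toReal_natCast, Finset.inter_filter, Finset.inter_univ, Finset.card_powersetCard,
    Finset.card_univ, Fintype.card_fin]
  have hpos : (0 : ℝ) < N.choose M := by exact_mod_cast Nat.choose_pos hMN
  rw [div_le_iff₀ hpos]
  refine le_trans ?_ (choose_mul_choose_le htM hMN htN ht)
  have := card_filter_le_card_inter_le (M := M) (t := t) b₀
  rw [hb₀] at this
  exact_mod_cast this

section
variable {Ω : Type*} [MeasurableSpace Ω] {P : Measure Ω}
  {p N K M : ℕ} {A : Matrix (Fin p) (Fin p) ℝ} {X : Fin N → Ω → EuclideanSpace ℝ (Fin p)}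
  {B : Fin K → Ω → Finset (Fin N)}

namespace IsBatchedGaussianSample

theorem measureReal_card_ne (h : IsBatchedGaussianSample P A M X B) (k : Fin K) :
    P.real {ω | (B k ω).card ≠ M} = 0 := by
  rw [(h.law_batch k).measureReal_eq (p := fun b => b.card ≠ M) (Set.toFinite _).measurableSet]
  have hfin : {b : Finset (Fin N) | b.card = M}.Finite := Set.toFinite _
  rw [Measure.real, ← uniformOn_inter_self hfin]
  have : {b : Finset (Fin N) | b.card = M} ∩ {b | b.card ≠ M} = ∅ := by
    ext b; simp
  rw [this]; simp

variable [IsProbabilityMeasure P]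

theorem batchSize_le (h : IsBatchedGaussianSample P A M X B) (k : Fin K) : M ≤ N := by
  by_contra hMN
  have h1 := h.measureReal_card_ne k
  have : {ω | (B k ω).card ≠ M} = Set.univ := by
    ext ω
    have := Finset.card_le_univ (B k ω)
    rw [Fintype.card_fin] at this
    simp only [Set.mem_ofPred_eq, Set.mem_univ, iff_true]
    omega
  rw [this] at h1
  simp at h1

theorem measureReal_le_card_inter_le (h : IsBatchedGaussianSample P A M X B) {k l : Fin K}
    (hkl : k ≠ l) {t : ℕ} (htN : 2 * t ≤ N) (ht : 12 * (M : ℝ) ^ 2 ≤ t * N) :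
    P.real {ω | t ≤ (B k ω ∩ B l ω).card} ≤ (1 / 2) ^ t := by
  have hMN := h.batchSize_le k
  set U := uniformOn {b : Finset (Fin N) | b.card = M}
  have hU : IsProbabilityMeasure U := (h.law_batch k).isProbabilityMeasure_iff.1 inferInstance
  have hlaw := (h.indep_batch.indepFun hkl).hasLaw_prod (h.law_batch k) (h.law_batch l)
  have hm : MeasurableSet {b : Finset (Fin N) × Finset (Fin N) | t ≤ (b.1 ∩ b.2).card} :=
    (Set.toFinite _).measurableSet
  rw [hlaw.measureReal_eq (p := fun b => t ≤ (b.1 ∩ b.2).card) hm]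
  have h0 : U.real {b | b.card ≠ M} = 0 := by
    rw [← (h.law_batch k).measureReal_eq (p := fun b => b.card ≠ M) (Set.toFinite _).measurableSet]
    exact h.measureReal_card_ne k
  have := measureReal_prod_le_add (μ := U) (ν := U) hm (B := {b | b.card ≠ M})
    (Set.toFinite _).measurableSet (r := (1 / 2) ^ t) (by positivity)
    fun b hb => uniformOn_le_card_inter_le hMN htN ht (by simpa using hb)
  rwa [h0, add_zero] at this

/-- Conditioning on the batches: since they are independent of the observations, a bound valid for
each fixed good choice of batches holds up to the probability of a bad choice. -/
theorem measureReal_le_of_forall_batches (h : IsBatchedGaussianSample P A M X B)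
    {E : (Fin K → Finset (Fin N)) → Set (Fin N → EuclideanSpace ℝ (Fin p))}
    (hE : ∀ b, MeasurableSet (E b)) {good : (Fin K → Finset (Fin N)) → Prop} {r : ℝ} (hr : 0 ≤ r)
    (hgood : ∀ b, good b → (Measure.pi fun _ : Fin N => multivariateGaussian 0 A).real (E b) ≤ r) :
    P.real {ω | (fun n => X n ω) ∈ E fun k => B k ω} ≤
      r + P.real {ω | ¬ good fun k => B k ω} := by
  set μ := Measure.pi fun _ : Fin N => multivariateGaussian 0 A
  have hX : HasLaw (fun ω n => X n ω) μ P := h.indep_obs.hasLaw_pi h.law_obs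
  have hBae : AEMeasurable (fun ω k => B k ω) P :=
    aemeasurable_pi_lambda _ fun k => (h.law_batch k).aemeasurable
  set ν := P.map fun ω k => B k ω
  have hB : HasLaw (fun ω k => B k ω) ν P := ⟨hBae, rfl⟩
  have : IsProbabilityMeasure ν := Measure.isProbabilityMeasure_map hBae
  have hlaw := h.indep_obs_batch.symm.hasLaw_prod hB hX
  have hm : MeasurableSet {y : (Fin K → Finset (Fin N)) × (Fin N → EuclideanSpace ℝ (Fin p)) |
      y.2 ∈ E y.1} := by
    have : {y : (Fin K → Finset (Fin N)) × (Fin N → EuclideanSpace ℝ (Fin p)) | y.2 ∈ E y.1} =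
        ⋃ b, {b} ×ˢ E b := by
      ext ⟨b, x⟩; simp
    rw [this]
    exact MeasurableSet.iUnion fun b => (measurableSet_singleton b).prod (hE b)
  have hg : MeasurableSet {b | ¬ good b} := (Set.toFinite _).measurableSet
  rw [hlaw.measureReal_eq (p := fun y => y.2 ∈ E y.1) hm, hB.measureReal_eq hg]
  exact measureReal_prod_le_add hm hg hr fun b hb => hgood b (not_not.1 hb)

end IsBatchedGaussianSample
end

/-! ### Combining the bounds -/

section
variable {p N K M : ℕ} {A : Matrix (Fin p) (Fin p) ℝ} {i j : Fin p}

theorem measurableSet_forall_sum_sampleResidual_pos (b : Fin K → Finset (Fin N))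
    (S : Fin K → Finset (Fin p)) (w : Fin K → Fin p → ℝ) :
    MeasurableSet {x : Fin N → EuclideanSpace ℝ (Fin p) |
      ∀ k, 0 < ∑ n ∈ b k, sampleResidual x (b k) j (S k) n * (w k ⬝ᵥ (x n).ofLp)} := by
  rw [Set.ofPred_forall]
  exact MeasurableSet.iInter fun k => measurableSet_lt measurable_const
    (Finset.measurable_sum _ fun n _ => (measurable_sampleResidual (b k) j (S k) n).mul
      (measurable_dotProduct_sample (w k) n))

/-- A single batch, which has no shared part, already gives a bound that suffices for boundedly
many batches. -/
theorem measureReal_forall_stat_pos_le_gaussianUpper (hA : A.PosSemidef) (k₀ : Fin K)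
    {w : Fin K → Fin p → ℝ} {S : Fin K → Finset (Fin p)}
    (hw : ∀ k, w k ⬝ᵥ A.mulVec (w k) = 1)
    (hwS : ∀ k, ∀ a ∈ insert j (S k), A.mulVec (w k) a = 0) (b : Fin K → Finset (Fin N)) :
    (Measure.pi fun _ : Fin N => multivariateGaussian 0 A).real
        {x | ∀ k, 0 < ∑ n ∈ b k, sampleResidual x (b k) j (S k) n * (w k ⬝ᵥ (x n).ofLp)} ≤
      gaussianUpper := by
  have h := measureReal_forall_stat_pos_le (K := 1) (j := j) hA (w := fun _ => w k₀)
    (S := fun _ => S k₀) (fun _ => hw k₀) (fun _ => hwS k₀) (b := fun _ => b k₀)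
    (D := fun _ => b k₀) (fun _ => le_rfl) (fun k l hkl => absurd (Subsingleton.elim k l) hkl)
  refine (measureReal_mono fun x (hx : ∀ k, _) (_ : Fin 1) => hx k₀).trans (h.trans (le_of_eq ?_))
  simp [not_lt.2 (Real.sqrt_nonneg _)]

/-- Removing from each batch its overlaps with the others, padded to a set of exactly `K * t`
samples, leaves parts that meet no other batch. -/
theorem exists_disjoint_parts {N K t s : ℕ} {b : Fin K → Finset (Fin N)}
    (hcard : ∀ k, s ≤ (b k).card) (hover : ∀ k l, k ≠ l → (b k ∩ b l).card ≤ t)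
    (hts : K * t ≤ s) :
    ∃ D : Fin K → Finset (Fin N), (∀ k, D k ⊆ b k) ∧ (∀ k l, k ≠ l → Disjoint (D k) (b l)) ∧
      ∀ k, (b k \ D k).card = K * t := by
  classical
  have hT : ∀ k, ∃ T, ((Finset.univ.erase k).biUnion fun l => b k ∩ b l) ⊆ T ∧ T ⊆ b k ∧
      T.card = K * t := by
    intro k
    refine Finset.exists_subsuperset_card_eq ?_ ?_ (hts.trans (hcard k))
    · exact Finset.biUnion_subset.2 fun l _ => Finset.inter_subset_left
    · refine (Finset.card_biUnion_le_card_mul _ _ t fun l hl =>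
        hover k l (Finset.ne_of_mem_erase hl).symm).trans ?_
      gcongr
      simp
  choose T hT1 hT2 hT3 using hT
  refine ⟨fun k => b k \ T k, fun k => Finset.sdiff_subset, fun k l hkl => ?_, fun k => ?_⟩
  · refine Finset.disjoint_left.2 fun n hn hl => ?_
    rw [Finset.mem_sdiff] at hn
    exact hn.2 (hT1 k (Finset.mem_biUnion.2 ⟨l, Finset.mem_erase.2 ⟨hkl.symm, Finset.mem_univ l⟩,
      Finset.mem_inter.2 ⟨hn.1, hl⟩⟩))
  · rw [Finset.sdiff_sdiff_eq_self (hT2 k), hT3]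

/-- For fixed batches with small overlaps, the shared part of a batch is a fraction of order `1 /
K` of it, so its contribution exceeds a standard deviation only with probability exponentially
small in `K`. -/
theorem measureReal_forall_stat_pos_le_of_overlap (hA : A.PosSemidef) {lo hi : ℝ} {r : ℕ}
    (hlo : 0 < lo) (hhi : 0 < hi)
    (h : BoundedPrincipalEigenvalues A (r + 1) lo hi)
    {w : Fin K → Fin p → ℝ} {S : Fin K → Finset (Fin p)}
    (hS : ∀ k, (insert j (S k)).card ≤ r)
    (hw : ∀ k, w k ⬝ᵥ A.mulVec (w k) = 1)
    (hwS : ∀ k, ∀ a ∈ insert j (S k), A.mulVec (w k) a = 0) {b : Fin K → Finset (Fin N)}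
    (hb : ∀ k, (b k).card = M) {t : ℕ} (hover : ∀ k l, k ≠ l → (b k ∩ b l).card ≤ t)
    (ht : (t : ℝ) * K ≤ 101 * (M / K)) (hK : 202 ≤ K) :
    (Measure.pi fun _ : Fin N => multivariateGaussian 0 A).real
        {x | ∀ k, 0 < ∑ n ∈ b k, sampleResidual x (b k) j (S k) n * (w k ⬝ᵥ (x n).ofLp)} ≤
      gaussianUpper ^ K + K * (Real.exp (-(lo / (808 * hi) * K) / 2) +
        8 * r ^ 2 * Real.exp (-(lo ^ 2 / (128 * r ^ 2 * hi ^ 2)) * (K * t : ℕ))) := by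
  have hK0 : (202 : ℝ) ≤ K := by exact_mod_cast hK
  have hKt : (K * t : ℝ) * K ≤ 101 * M := by
    rw [mul_div_assoc', le_div_iff₀ (by linarith)] at ht
    linarith
  have hKt2 : (2 : ℝ) * (K * t) ≤ M := by
    have : (0 : ℝ) ≤ K * t := by positivity
    nlinarith
  have hKt2' : 2 * (K * t) ≤ M := by exact_mod_cast hKt2
  obtain ⟨D, hDb, hdisj, hT⟩ := exists_disjoint_parts (s := M) (fun k => (hb k).ge) hover
    (by omega)
  refine (measureReal_forall_stat_pos_le hA hw hwS hDb hdisj).trans ?_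
  gcongr
  calc _ ≤ ∑ k : Fin K, (Real.exp (-(lo / (808 * hi) * K) / 2) +
        8 * r ^ 2 * Real.exp (-(lo ^ 2 / (128 * r ^ 2 * hi ^ 2)) * (K * t : ℕ))) := by
        refine Finset.sum_le_sum fun k _ => ?_
        have hDcard : (D k).card + K * t = M := by
          rw [← hT k, ← hb k, add_comm]
          exact Finset.card_sdiff_add_card_eq_card (hDb k)
        refine (measureReal_sqrt_lt_shared_le hA (hw k) (hwS k) (hDb k)
          (lo / (808 * hi) * K)).trans ?_
        gcongr
        have := measureReal_sampleResidual_lt_le (N := N) hA hlo h (hS k) (b k) (D := D k)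
          (T := b k \ D k) (κ := lo / (808 * hi) * K) (by rw [hT]; omega) (by positivity) ?_
        · rwa [hT k] at this
        · rw [hT k]
          have hDc : (M : ℝ) / 2 ≤ (D k).card := by
            have : ((D k).card : ℝ) + K * t = M := by exact_mod_cast hDcard
            linarith
          push_cast
          calc lo / (808 * hi) * K * (4 * hi * (K * t)) = lo * ((K * t * K) / 202) := by
                field_simp; ring
            _ ≤ lo * (D k).card := by gcongr; linarith
    _ = _ := by simp [mul_add]

end

/-- The only consequences of the choice of `M` and `K` that matter. The last one uses `γ > 3 / 4`,
in the form `K ≤ 2 N ^ (1 / 8)` and `M ≥ N ^ (3 / 4) - 1`. -/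
theorem sampling_sizes {γ : ℝ} (hγ : 3 / 4 < γ) (hγ1 : γ < 1) {N M K : ℕ} (hN : 0 < N)
    (hM : |(M : ℝ) - (N : ℝ) ^ γ| < 1) (hK : |(K : ℝ) - (N : ℝ) ^ ((1 - γ) / 2)| < 1) :
    0 < K ∧ (N : ℝ) ^ ((1 - γ) / 2) ≤ K + 1 ∧ (M : ℝ) * K ^ 2 ≤ 8 * N ∧
      (202 ≤ K → K ^ 3 ≤ M) := by
  have hN1 : (1 : ℝ) ≤ N := by exact_mod_cast hN
  have hN0 : (0 : ℝ) < N := by linarith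
  set m := (N : ℝ) ^ γ with hm
  set k := (N : ℝ) ^ ((1 - γ) / 2) with hk
  have hm1 : 1 ≤ m := Real.one_le_rpow hN1 (by linarith)
  have hk1 : 1 ≤ k := Real.one_le_rpow hN1 (by linarith)
  obtain ⟨hM1, hM2⟩ := abs_lt.1 hM
  obtain ⟨hK1, hK2⟩ := abs_lt.1 hK
  have hmk : m * k ^ 2 = N := by
    rw [hm, hk, ← Real.rpow_natCast, ← Real.rpow_mul hN0.le, ← Real.rpow_add hN0]
    rw [show γ + (1 - γ) / 2 * (2 : ℕ) = 1 by push_cast; ring, Real.rpow_one]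
  refine ⟨?_, by linarith, ?_, fun h202 => ?_⟩
  · have : (0 : ℝ) < K := by linarith
    exact_mod_cast this
  · calc (M : ℝ) * (K : ℝ) ^ 2 ≤ (2 * m) * (2 * k) ^ 2 := by
          gcongr <;> linarith
      _ = 8 * (N : ℝ) := by rw [← hmk]; ring
  · have h202' : (202 : ℝ) ≤ K := by exact_mod_cast h202
    set e := (N : ℝ) ^ (1 / 8 : ℝ) with he
    have hke : k ≤ e := Real.rpow_le_rpow_of_exponent_le hN1 (by linarith)
    have hem : e ^ 6 ≤ m := by
      rw [he, hm, ← Real.rpow_natCast, ← Real.rpow_mul hN0.le]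
      exact Real.rpow_le_rpow_of_exponent_le hN1 (by push_cast; linarith)
    have hKe : (K : ℝ) / 2 ≤ e := by linarith
    have h6 : ((K : ℝ) / 2) ^ 6 ≤ m := (by gcongr : ((K : ℝ) / 2) ^ 6 ≤ e ^ 6).trans hem
    have h3 : (202 : ℝ) ^ 3 ≤ (K : ℝ) ^ 3 := by gcongr
    have h7 : (K : ℝ) ^ 3 * 202 ^ 3 ≤ (K : ℝ) ^ 3 * K ^ 3 := by gcongr
    have : (K : ℝ) ^ 3 ≤ M := by nlinarith
    exact_mod_cast this

theorem exists_threshold_quadratic_mul_exp_le {c L : ℝ} (hc : 0 < c) :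
    ∃ K₀ : ℕ, 202 ≤ K₀ ∧ ∀ K : ℕ, K₀ ≤ K →
      L * (K : ℝ) ^ 2 * Real.exp (-(c * K)) ≤ Real.exp (-(c / 2 * K)) := by
  -- From `(c / 2 * K) ^ 3 / 3! ≤ exp (c / 2 * K)`.
  refine ⟨max 202 ⌈48 * L / c ^ 3⌉₊, le_max_left _ _, fun K hK => ?_⟩
  have h1 : 48 * L / c ^ 3 ≤ K :=
    (Nat.le_ceil _).trans (by exact_mod_cast (le_max_right _ _).trans hK)
  rw [div_le_iff₀ (by positivity)] at h1
  have h2 := Real.pow_div_factorial_le_exp (c / 2 * K) (by positivity) 3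
  have h3 : L * (K : ℝ) ^ 2 ≤ Real.exp (c / 2 * K) := by
    refine le_trans ?_ h2
    rw [show (Nat.factorial 3 : ℝ) = 6 by norm_num [Nat.factorial], le_div_iff₀ (by norm_num)]
    have : 0 ≤ (K : ℝ) ^ 2 := by positivity
    nlinarith
  calc _ ≤ Real.exp (c / 2 * K) * Real.exp (-(c * K)) := by gcongr
    _ = _ := by rw [← Real.exp_add]; congr 1; ring

theorem exists_threshold_failure_bound_le {q c₁ c₂ L : ℝ} (hq0 : 0 < q) (hq1 : q < 1)
    (hc₁ : 0 < c₁) (hc₂ : 0 < c₂) (hL : 0 ≤ L) :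
    ∃ c : ℝ, 0 < c ∧ ∃ K₀ : ℕ, 202 ≤ K₀ ∧ ∀ K : ℕ, K₀ ≤ K → ∀ t : ℕ, K ≤ t →
      q ^ K + K * (Real.exp (-(c₂ * K) / 2) + L * Real.exp (-c₁ * (K * t : ℕ))) +
        K ^ 2 * (1 / 2) ^ t ≤ Real.exp (-(c * K)) := by
  set c := min (min (Real.log 2) (-Real.log q)) (min c₁ (c₂ / 2)) with hc
  have hlq : 0 < -Real.log q := neg_pos.2 (Real.log_neg hq0 hq1)
  have hcpos : 0 < c :=
    lt_min (lt_min (Real.log_pos (by norm_num)) hlq) (lt_min hc₁ (by positivity))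
  have hc_log2 : c ≤ Real.log 2 := (min_le_left _ _).trans (min_le_left _ _)
  have hc_q : c ≤ -Real.log q := (min_le_left _ _).trans (min_le_right _ _)
  have hc_c₁ : c ≤ c₁ := (min_le_right _ _).trans (min_le_left _ _)
  have hc_c₂ : c ≤ c₂ / 2 := (min_le_right _ _).trans (min_le_right _ _)
  obtain ⟨K₀, hK₀, hthr⟩ := exists_threshold_quadratic_mul_exp_le (L := 3 + L) hcpos
  refine ⟨c / 2, by positivity, K₀, hK₀, fun K hlarge t htK' => ?_⟩
  have hK1 : (202 : ℝ) ≤ K := by exact_mod_cast hK₀.trans hlarge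
  have htK : (K : ℝ) ≤ t := by exact_mod_cast htK'
  have hK0 : (0 : ℝ) ≤ K := by linarith
  have e1 : q ^ K ≤ Real.exp (-(c * K)) := by
    rw [← Real.exp_log hq0, ← Real.exp_nat_mul, Real.exp_le_exp]
    nlinarith
  have e2 : Real.exp (-(c₂ * K) / 2) ≤ Real.exp (-(c * K)) := by
    rw [Real.exp_le_exp]
    have := mul_le_mul_of_nonneg_right hc_c₂ hK0
    linarith
  have e3 : Real.exp (-c₁ * (K * t : ℕ)) ≤ Real.exp (-(c * K)) := by
    rw [Real.exp_le_exp]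
    push_cast
    have h1 : c * K ≤ c₁ * (K * t) := by
      have : (K : ℝ) ≤ K * t := by nlinarith
      gcongr
    linarith
  have e4 : ((1 : ℝ) / 2) ^ t ≤ Real.exp (-(c * K)) := by
    calc ((1 : ℝ) / 2) ^ t ≤ (1 / 2) ^ K :=
          pow_le_pow_of_le_one (by norm_num) (by norm_num) htK'
      _ = Real.exp (-(Real.log 2 * K)) := by
          rw [← neg_mul, mul_comm, ← Real.log_inv, Real.exp_nat_mul,
            Real.exp_log (by norm_num)]
          norm_num
      _ ≤ _ := by
          rw [Real.exp_le_exp]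
          have := mul_le_mul_of_nonneg_right hc_log2 hK0
          linarith
  have hKsq : (K : ℝ) ≤ K ^ 2 := by nlinarith
  have hone : (1 : ℝ) ≤ K ^ 2 := by nlinarith
  have hE0 : 0 < Real.exp (-(c * K)) := Real.exp_pos _
  set E := Real.exp (-(c * K))
  calc _ ≤ E + K * (E + L * E) + K ^ 2 * E := by gcongr
    _ ≤ K ^ 2 * E + K ^ 2 * (E + L * E) + K ^ 2 * E := by
        gcongr
        exact le_mul_of_one_le_left hE0.le hone
    _ = (3 + L) * K ^ 2 * E := by ring
    _ ≤ Real.exp (-(c / 2 * K)) := hthr K hlarge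

/-- A threshold of about `100 M / K²` for the pairwise overlaps: it exceeds the typical overlap
`M² / N` by a constant factor, and it is at least `K`. -/
theorem exists_overlap_threshold {N M K : ℕ} (h202 : 202 ≤ K) (hKM : K ^ 3 ≤ M) (hMN : M ≤ N)
    (hMK : (M : ℝ) * K ^ 2 ≤ 8 * N) :
    ∃ t : ℕ, K ≤ t ∧ (t : ℝ) * K ≤ 101 * (M / K) ∧ 2 * t ≤ N ∧ 12 * (M : ℝ) ^ 2 ≤ t * N := by
  have h202' : (202 : ℝ) ≤ K := by exact_mod_cast h202
  have hM3 : (K : ℝ) ^ 3 ≤ M := by exact_mod_cast hKM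
  set t := ⌈100 * (M : ℝ) / K ^ 2⌉₊ with ht
  have hMK2 : (K : ℝ) ≤ M / K ^ 2 := by
    rw [le_div_iff₀ (by positivity)]; linarith
  have ht1 : 100 * (M / K ^ 2 : ℝ) ≤ t := by
    rw [mul_div_assoc']; exact Nat.le_ceil _
  have ht2 : (t : ℝ) ≤ 101 * (M / K ^ 2) := by
    have := Nat.ceil_lt_add_one (a := 100 * (M : ℝ) / K ^ 2) (by positivity)
    rw [← ht, mul_div_assoc] at this
    linarith
  have htK : (K : ℝ) ≤ t := by linarith
  have htK' : K ≤ t := by exact_mod_cast htK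
  have htM : (t : ℝ) * K ≤ 101 * (M / K) := by
    calc (t : ℝ) * K ≤ 101 * (M / K ^ 2) * K := by gcongr
      _ = _ := by field_simp
  have htN : 2 * t ≤ N := by
    refine le_trans ?_ hMN
    have h1 : (M : ℝ) / K ^ 2 * 202 ≤ M := by
      rw [div_mul_eq_mul_div, div_le_iff₀ (by positivity)]
      have : (0 : ℝ) ≤ M := by positivity
      gcongr
      nlinarith
    have : (2 * t : ℝ) ≤ M := by linarith
    exact_mod_cast this
  have htN2 : 12 * (M : ℝ) ^ 2 ≤ t * N := by
    have h1 : (M : ℝ) ≤ 8 * N / K ^ 2 := by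
      rw [le_div_iff₀ (by positivity)]; exact hMK
    calc 12 * (M : ℝ) ^ 2 = 12 * M * M := by ring
      _ ≤ 12 * M * (8 * N / K ^ 2) := by gcongr
      _ = 96 * (M / K ^ 2) * N := by ring
      _ ≤ t * N := by
        gcongr
        have : (0 : ℝ) ≤ M / K ^ 2 := by positivity
        linarith
  exact ⟨t, htK', htM, htN, htN2⟩

theorem IsBatchedGaussianSample.measureReal_not_spread_le {Ω : Type*} [MeasurableSpace Ω]
    {P : Measure Ω} [IsProbabilityMeasure P] {p N K M : ℕ} {A : Matrix (Fin p) (Fin p) ℝ}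
    {X : Fin N → Ω → EuclideanSpace ℝ (Fin p)} {B : Fin K → Ω → Finset (Fin N)}
    (h : IsBatchedGaussianSample P A M X B) {t : ℕ} (htN : 2 * t ≤ N)
    (ht : 12 * (M : ℝ) ^ 2 ≤ t * N) :
    P.real {ω | ¬ ((∀ k, (B k ω).card = M) ∧ ∀ k l, k ≠ l → (B k ω ∩ B l ω).card < t)} ≤
      K ^ 2 * (1 / 2) ^ t := by
  calc _ ≤ P.real ((⋃ k, {ω | (B k ω).card ≠ M}) ∪
        ⋃ k, ⋃ l, {ω | k ≠ l ∧ t ≤ (B k ω ∩ B l ω).card}) := by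
        refine measureReal_mono fun ω hω => ?_
        simp only [Set.mem_ofPred_eq, not_and_or, not_forall, not_lt] at hω
        simp only [Set.mem_union, Set.mem_iUnion]
        rcases hω with ⟨k, hk⟩ | ⟨k, l, hkl, hl⟩
        · exact Or.inl ⟨k, hk⟩
        · exact Or.inr ⟨k, l, hkl, hl⟩
    _ ≤ ∑ k, P.real {ω | (B k ω).card ≠ M} +
        ∑ k, ∑ l, P.real {ω | k ≠ l ∧ t ≤ (B k ω ∩ B l ω).card} := by
        refine (measureReal_union_le _ _).trans ?_
        gcongr
        · exact measureReal_iUnion_fintype_le _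
        · refine (measureReal_iUnion_fintype_le _).trans (Finset.sum_le_sum fun k _ => ?_)
          exact measureReal_iUnion_fintype_le _
    _ ≤ ∑ _k : Fin K, 0 + ∑ _k : Fin K, ∑ _l : Fin K, (1 / 2) ^ t := by
        gcongr with k _ k _ l _
        · exact (h.measureReal_card_ne k).le
        · by_cases hkl : k = l
          · simp [hkl]
          · simpa [hkl] using h.measureReal_le_card_inter_le hkl htN ht
    _ = K ^ 2 * (1 / 2) ^ t := by simp; ring

theorem lemma1 (d : ℕ) (σmin σmax : ℝ) (hσmin : 0 < σmin) (hσmax : 0 < σmax) :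
    ∃ C : ℝ, 0 < C ∧ ∃ N₀ : ℕ, 0 < N₀ ∧
      ∀ (γ : ℝ), 3 / 4 < γ → γ < 1 →
      ∀ (N M K : ℕ), N₀ ≤ N →
      -- `M` and `K` are `N ^ γ` and `N ^ ((1 - γ) / 2)`, rounded up or down
      |(M : ℝ) - (N : ℝ) ^ γ| < 1 →
      |(K : ℝ) - (N : ℝ) ^ ((1 - γ) / 2)| < 1 →
      ∀ (p : ℕ) (A : Matrix (Fin p) (Fin p) ℝ) (G : SimpleGraph (Fin p)),
      IsGaussianGraphicalModel A G →
      (∀ v, (G.neighborSet v).ncard ≤ d) →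
      BoundedPrincipalEigenvalues A (d + 4) σmin σmax →
      ∀ (i j : Fin p), i ≠ j → ¬ G.Adj i j →
      ∀ (S : Fin K → Finset (Fin p)),
      (∀ k, i ∉ S k ∧ j ∉ S k ∧ (S k).card ≤ d + 2 ∧ partialCorr A i j (S k) = 0) →
      ∀ {Ω : Type*} [MeasurableSpace Ω] (P : Measure Ω) [IsProbabilityMeasure P]
        (X : Fin N → Ω → EuclideanSpace ℝ (Fin p)) (B : Fin K → Ω → Finset (Fin N)),
      IsBatchedGaussianSample P A M X B →
      P.real {ω | ∀ k, 0 < partialCorr (sampleCov (fun n => X n ω) (B k ω)) i j (S k)}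
        ≤ Real.exp (-C * (N : ℝ) ^ min ((1 - γ) / 2) (4 * γ - 3)) := by
  set r : ℕ := d + 3 with hr
  set q := gaussianUpper with hq
  have hq0 : 0 < q := gaussianUpper_pos
  have hlq : 0 < -Real.log q := by
    have := Real.log_neg hq0 gaussianUpper_lt_one
    linarith
  have hrpos : (0 : ℝ) < r := by rw [hr]; positivity
  set c₁ := σmin ^ 2 / (128 * r ^ 2 * σmax ^ 2) with hc₁
  obtain ⟨c, hcpos, K₀, hK₀, hthr⟩ := exists_threshold_failure_bound_le (q := q) (c₁ := c₁)
    (c₂ := σmin / (808 * σmax)) (L := 8 * r ^ 2) hq0 gaussianUpper_lt_one (by positivity)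
    (by positivity) (by positivity)
  set C := min (c / 2) (-Real.log q / (K₀ + 1)) with hC
  have hCpos : 0 < C := lt_min (by positivity) (by positivity)
  refine ⟨C, hCpos, 1, one_pos, ?_⟩
  intro γ hγ hγ1 N M K hN hM hK p A G hAG _ hbd i j hij _ S hS Ω _ P _ X B hXB
  obtain ⟨hKpos, hNK, hMK, hMK3⟩ := sampling_sizes hγ hγ1 hN hM hK
  have hN1 : (1 : ℝ) ≤ N := by exact_mod_cast hN
  have hK1 : (1 : ℝ) ≤ K := by exact_mod_cast hKpos
  have hA := hAG.1
  choose w hw hwi hwsupp hwS using fun k => exists_resampling_direction hA (hS k).2.2.2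
  have hwS' : ∀ k, ∀ a ∈ insert j (S k), A.mulVec (w k) a = 0 := fun k => hwS k (hS k).1 hij
  have hcard : ∀ k, (insert j (S k)).card ≤ r := fun k =>
    (Finset.card_insert_le _ _).trans (Nat.succ_le_succ (hS k).2.2.1)
  have hevent := measureReal_mono (μ := P)
    (s₁ := {ω | ∀ k, 0 < partialCorr (sampleCov (fun n => X n ω) (B k ω)) i j (S k)})
    (s₂ := {ω | (fun n => X n ω) ∈ {x : Fin N → EuclideanSpace ℝ (Fin p) | ∀ k,
      0 < ∑ n ∈ B k ω, sampleResidual x (B k ω) j (S k) n * (w k ⬝ᵥ (x n).ofLp)}})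
    (fun ω hω k => sum_sampleResidual_mul_pos hij (hS k).1 (hS k).2.1 (hwi k) (hwsupp k) (hω k))
  have hE := fun b : Fin K → Finset (Fin N) =>
    measurableSet_forall_sum_sampleResidual_pos (j := j) b S w
  have hpow : (N : ℝ) ^ min ((1 - γ) / 2) (4 * γ - 3) ≤ K + 1 :=
    (Real.rpow_le_rpow_of_exponent_le hN1 (min_le_left _ _)).trans hNK
  refine hevent.trans ?_
  -- `N ^ min _ _ ≤ K + 1`, so the right side is bounded below while `K` is bounded.
  rcases lt_or_ge K K₀ with hsmall | hlarge
  · have h1 := hXB.measureReal_le_of_forall_batches hE (good := fun _ => True) hq0.le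
      fun b _ => measureReal_forall_stat_pos_le_gaussianUpper hA.posSemidef ⟨0, hKpos⟩ hw hwS' b
    simp only [not_true_eq_false, Set.ofPred_false, measureReal_empty, add_zero] at h1
    refine h1.trans ?_
    rw [← Real.exp_log hq0, Real.exp_le_exp]
    have hKK : (K : ℝ) + 1 ≤ K₀ + 1 := by
      have : (K : ℝ) ≤ K₀ := by exact_mod_cast hsmall.le
      linarith
    have h2 : C * (K₀ + 1) ≤ -Real.log q := by
      rw [← le_div_iff₀ (by positivity)]
      exact min_le_right _ _
    have h3 := mul_le_mul_of_nonneg_left (hpow.trans hKK) hCpos.le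
    linarith
  · have h202 : 202 ≤ K := hK₀.trans hlarge
    obtain ⟨t, htK', htM, htN, htN2⟩ := exists_overlap_threshold h202 (hMK3 h202)
      (hXB.batchSize_le ⟨0, hKpos⟩) hMK
    set good : (Fin K → Finset (Fin N)) → Prop := fun b =>
      (∀ k, (b k).card = M) ∧ ∀ k l, k ≠ l → (b k ∩ b l).card < t with hgood
    have hcond := hXB.measureReal_le_of_forall_batches hE (good := good) (r := q ^ K + K *
      (Real.exp (-(σmin / (808 * σmax) * K) / 2) + 8 * r ^ 2 * Real.exp (-c₁ * (K * t : ℕ))))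
      (by positivity) fun b hb =>
        measureReal_forall_stat_pos_le_of_overlap hA.posSemidef hσmin hσmax hbd hcard hw hwS'
          hb.1 (fun k l hkl => (hb.2 k l hkl).le) htM h202
    have hbad := hXB.measureReal_not_spread_le htN htN2
    refine (hcond.trans (add_le_add_right hbad _)).trans ?_
    refine (hthr K hlarge t htK').trans ?_
    rw [Real.exp_le_exp]
    have h1 : C ≤ c / 2 := min_le_left _ _
    have h2 := mul_le_mul h1 hpow (by positivity) (by positivity)
    have h3 := mul_le_mul_of_nonneg_left hK1 hcpos.le
    linarith
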